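/- Let $V$ be a Euclidean Jordan algebra: a finite-dimensional real vector space with an inner product $\langle\cdot,\cdot\rangle$ and a commutative bilinear product $\circ$ with unit $u$ such that, writing $x^2=x\circ x$, one has $x^2\circ(x\circ y)=x\circ(x^2\circ y)$ and $\langle x\circ y,z\rangle=\langle x,y\circ z\rangle$ for all $x,y,z$. Write $\mathrm{tr}\,x=\langle x,u\rangle$. The positive cone of $V$ is $\mathcal Q_V=\{x^2 : x\in V\}$, and a state is an element $\rho\in\mathcal Q_V$ with $\mathrm{tr}\,\rho=1$. Every $x\in V$ has a spectral decomposition $x=\sum_i\lambda_ic_i$, where the $\lambda_i$ are distinct reals and the $c_i$ are nonzero idempotents with $c_i\circ c_j=0$ for $i\ne j$ and $\sum_ic_i=u$; it is unique up to order, and $f(x):=\sum_if(\lambda_i)c_i$ for $f:\mathbb R\to\mathbb R$. For states $\rho,\sigma$ let $c$ be the idempotent of $\sigma$ belonging to the eigenvalue $0$ ($c=0$ if $0$ is not an eigenvalue). The relative entropy is $$D(\rho\|\sigma)=\begin{cases}\mathrm{tr}\left(\rho\circ\log\rho-\rho\circ\log\sigma\right)&\text{if }\mathrm{tr}(\rho\circ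 c)=0,\\+\infty&\text{otherwise,}\end{cases}$$ with the convention $\log 0:=0$ on the eigenvalue $0$ (so that $0\log0=0$). If $\sigma$ is invertible, the first case always applies. For Euclidean Jordan algebras $V,W$, give $V\otimes W$ the bilinear product determined by $(a_1\otimes b_1)\circ(a_2\otimes b_2)=(a_1\circ a_2)\otimes(b_1\circ b_2)$. A linear map $\kappa:V\to V$ is trace preserving if $\mathrm{tr}\,\kappa(x)=\mathrm{tr}\,x$ for all $x\in V$. It is completely positive if, for every Euclidean Jordan algebra $W$ for which $V\otimes W$ with this product (and the product inner product) is again a Euclidean Jordan algebra, $\kappa\otimes\mathrm{id}_W$ maps the set of squares $\{z\circ z : z\in V\otimes W\}$ into itself. (The condition on $W$ holds, for example, for $W=\mathbb R$.) A TPCP map is a trace preserving, completely positive linear map. Theorem. Let $\rho,\sigma$ be states in $V$ and let $\kappa:V\to V$ be a TPCP map. Then $$D(\rho\|\sigma)\ \ge\ D(\kappa(\rho)\|\kappa(\sigma)),$$ as an inequality in $\mathbb R\cup\{+\infty\}$. -/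

import Mathlib

open scoped TensorProduct

noncomputable section

/-- A (unital) Euclidean Jordan algebra: a finite-dimensional real vector space with an inner
product and a commutative bilinear product `x * y` (the Jordan product `x ∘ y`) with unit `1`,
satisfying the Jordan identity (`IsCommJordan`), such that multiplication is self-adjoint for the
inner product. Associativity of the product is not assumed. -/
class EuclideanJordanAlgebra (V : Type*) [NonAssocCommRing V] [Module ℝ V] extends
    IsCommJordan V, SMulCommClass ℝ V V, IsScalarTower ℝ V V, Module.Finite ℝ V,
    toInnerCore : InnerProductSpace.Core ℝ V where
  inner_mul_assoc : ∀ x y z : V, inner (x * y) z = inner x (y * z)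

namespace EuclideanJordanAlgebra

instance instInner {V : Type*} [NonAssocCommRing V] [Module ℝ V] [EuclideanJordanAlgebra V] :
    Inner ℝ V :=
  toInnerCore.toInner

/-- The set of squares `{x ∘ x}` of an algebra; for a Euclidean Jordan algebra this is its
canonical positive cone. -/
def squareCone (A : Type*) [Mul A] : Set A := {y | ∃ x : A, y = x * x}

section

variable {V : Type*} [NonAssocCommRing V] [Module ℝ V] [EuclideanJordanAlgebra V]

/-- The trace `tr x = ⟨x, u⟩`, where `u = 1` is the unit. -/
def tr (x : V) : ℝ := inner ℝ x 1

/-- A state: an element of the positive cone with `⟨ρ, u⟩ = 1`. -/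
structure IsState (ρ : V) : Prop where
  mem_cone : ρ ∈ squareCone V
  inner_one : inner ℝ ρ (1 : V) = 1

/-- A complete system of orthogonal idempotents. -/
structure IsCSOI {n : ℕ} (c : Fin n → V) : Prop where
  orthogonal : ∀ i j, i ≠ j → c i * c j = 0
  idempotent : ∀ i, c i * c i = c i
  complete : ∑ i, c i = 1

/-- `x = ∑ i, l i • c i` is the spectral decomposition of `x`: the `l i` are distinct reals and the
`c i` are a complete system of nonzero orthogonal idempotents. -/
structure IsSpectralDecomposition {n : ℕ} (x : V) (l : Fin n → ℝ) (c : Fin n → V) : Prop where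
  csoi : IsCSOI c
  ne_zero : ∀ i, c i ≠ 0
  distinct : Function.Injective l
  eq_sum : x = ∑ i, l i • c i

/-- `y` is a value of `f` at `x`, that is `y = ∑ i, f (l i) • c i` for a spectral decomposition
`x = ∑ i, l i • c i`. -/
def IsFunctionValue (f : ℝ → ℝ) (x y : V) : Prop :=
  ∃ (n : ℕ) (l : Fin n → ℝ) (c : Fin n → V),
    IsSpectralDecomposition x l c ∧ y = ∑ i, f (l i) • c i

open Classical in
/-- The functional calculus `f(x) = ∑ i, f (l i) • c i`. By the spectral theorem every `x` has a
spectral decomposition, unique up to order, so the value `0` of the other branch is never used. -/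
def apply (f : ℝ → ℝ) (x : V) : V :=
  if h : ∃ y, IsFunctionValue f x y then h.choose else 0

/-- The logarithm of an element with nonnegative eigenvalues; on the kernel idempotent it takes
the value `0` (since `Real.log 0 = 0`). -/
def log (x : V) : V := apply Real.log x

/-- The idempotent projecting onto the kernel of `x` (zero iff `x` has no eigenvalue `0`). -/
def kernelIdempotent (x : V) : V := apply (fun t => if t = 0 then 1 else 0) x

open Classical in
/-- The relative entropy `D(ρ‖σ) = tr (ρ ∘ log ρ - ρ ∘ log σ)` of two states, with the usual
conventions for states that are not invertible: `0 log 0 = 0`, and `D(ρ‖σ) = +∞` if the support of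
`ρ` is not contained in that of `σ`, i.e. if `tr (ρ ∘ c) ≠ 0` for the kernel idempotent `c` of
`σ`. -/
def relativeEntropy (ρ σ : V) : EReal :=
  if tr (ρ * kernelIdempotent σ) = 0 then ((tr (ρ * log ρ - ρ * log σ) : ℝ) : EReal) else ⊤

end

section

variable {V₁ V₂ : Type*} [NonAssocCommRing V₁] [Module ℝ V₁] [EuclideanJordanAlgebra V₁]
  [NonAssocCommRing V₂] [Module ℝ V₂] [EuclideanJordanAlgebra V₂]

/-- A linear map is trace preserving. -/
def IsTracePreserving (κ : V₁ →ₗ[ℝ] V₂) : Prop := ∀ x, tr (κ x) = tr x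

variable (V₁ V₂) in
/-- The composite `V₁ ⊗ V₂` with the product `(a₁ ⊗ b₁) ∘ (a₂ ⊗ b₂) = (a₁ ∘ a₂) ⊗ (b₁ ∘ b₂)`
(Mathlib's multiplication on the tensor product) is a Euclidean Jordan algebra. Finite
dimensionality, unitality, commutativity, and the self-adjointness of multiplication for the
product inner product are automatic; the Jordan identity is not. -/
def CompositeIsJordan : Prop :=
  ∀ x y : V₁ ⊗[ℝ] V₂, (x * y) * (x * x) = x * (y * (x * x))

/-- Complete positivity: for every Euclidean Jordan algebra `W` such that the composites
`V₁ ⊗ W` and `V₂ ⊗ W` are Euclidean Jordan algebras, the map `κ ⊗ id` is positive, i.e. maps the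
cone of squares of `V₁ ⊗ W` into that of `V₂ ⊗ W`. As `W` is finite dimensional, it is isomorphic
to an algebra in `Type`, so restricting `W` to `Type` loses nothing. -/
def IsCompletelyPositive (κ : V₁ →ₗ[ℝ] V₂) : Prop :=
  ∀ (W : Type) [NonAssocCommRing W] [Module ℝ W] [EuclideanJordanAlgebra W],
    CompositeIsJordan V₁ W → CompositeIsJordan V₂ W →
      ∀ z ∈ squareCone (V₁ ⊗[ℝ] W), TensorProduct.map κ LinearMap.id z ∈ squareCone (V₂ ⊗[ℝ] W)

/-- A trace preserving and completely positive linear map. -/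
structure IsTPCP (κ : V₁ →ₗ[ℝ] V₂) : Prop where
  tracePreserving : IsTracePreserving κ
  completelyPositive : IsCompletelyPositive κ

end

end EuclideanJordanAlgebra

end

/-! The inequality follows from Frenkel's integral formula, valid when tr ρ = tr σ and ρ is
supported in σ: D(ρ‖σ) = ∫ tr (σ + u(ρ - σ))₋ du / (u²|u - 1|), over all real u
(`lintegral_relativeEntropy`). The trace of the negative part, tr x₋, is the minimum of tr q over x
= p - q with p, q in the cone, so a positive trace preserving map cannot increase it
(`trNeg_map_le`). The integrands therefore compare pointwise. Of complete positivity only the case W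
= ℝ is needed.

For the formula, write tr x₋ as the integral over r > 0 of the trace of the negative spectral
projection of x + r·1, and exchange the integrals. For fixed r put y = σ + r·1 and E = ρ - σ. A cone
automorphism Γ = exp(2L(b)) takes 1 to y, and spectrally decomposing Γ⁻¹E = ∑ ξₖcₖ gives y + uE =
Γ(∑ (1 + uξₖ)cₖ). By the law of inertia (`tr_negIndicator_flow`) the negative projections of both
sides have the same trace for almost every u. Thus the u-integral reduces to the scalar integral
`lintegral_weight`, with value ξ - log(1 + ξ), and sums to ⟨E, y⁻¹⟩ - tr log(y + E) + tr log y
(`lintegral_pencil`). Integrating this over r gives D(ρ‖σ) (`lintegral_entropy`).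

Inertia rests on d/ds tr f(x) = ⟨f'(x), x'⟩ (in integrated form, `tr_apply_sub_eq`), which vanishes
along the flow if f is locally constant on the spectrum. The fundamental formula P(Γz) = ΓP(z)Γ
keeps the spectrum away from 0, so a smoothed sign function is such an f. -/

noncomputable section

namespace EuclideanJordanAlgebra

open Polynomial

/-! ### Power associativity, spectral theorem and functional calculus. -/

section Algebra

variable {V : Type*} [NonAssocCommRing V] [Module ℝ V] [EuclideanJordanAlgebra V]

/-- The norm of the inner product of a Euclidean Jordan algebra. -/
instance instNormedAddCommGroup : NormedAddCommGroup V :=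
  toInnerCore.toNormedAddCommGroup

instance instInnerProductSpace : InnerProductSpace ℝ V :=
  InnerProductSpace.ofCore toInnerCore.toCore

/-- Multiplication by `x` as a linear map. -/
def lmul (x : V) : Module.End ℝ V := LinearMap.mulLeft ℝ x

@[simp] theorem lmul_apply (x y : V) : lmul x y = x * y := rfl

theorem jordan_linearized (a b c d : V) :
    a * (b * c * d) + b * (c * a * d) + c * (a * b * d) =
      b * c * (a * d) + c * a * (b * d) + a * b * (c * d) := by
  have h := DFunLike.congr_fun (two_nsmul_lie_lmul_lmul_add_add_eq_zero a b c) d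
  change 2 • ((a * (b * c * d) - b * c * (a * d)) + (b * (c * a * d) - c * a * (b * d)) +
    (c * (a * b * d) - a * b * (c * d))) = 0 at h
  rw [← ofNat_smul_eq_nsmul ℝ] at h
  have h2 := (smul_eq_zero.mp h).resolve_left two_ne_zero
  rw [← sub_eq_zero, ← h2]
  abel

theorem lmul_jordan (a b c : V) :
    lmul a * lmul (b * c) + lmul b * lmul (c * a) + lmul c * lmul (a * b) =
      lmul (b * c) * lmul a + lmul (c * a) * lmul b + lmul (a * b) * lmul c :=
  LinearMap.ext fun d => jordan_linearized a b c d

/-- The right side of `jordan_linearized` is symmetric in c and d, so its left side is too; solving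
for (abc)d gives the operator identity. It reduces L of a product to L of shorter ones. -/
theorem lmul_mul_mul (a b c : V) :
    lmul (a * b * c) = lmul a * lmul (b * c) + lmul b * lmul (c * a) + lmul c * lmul (a * b)
      - lmul a * lmul c * lmul b - lmul b * lmul c * lmul a := by
  ext d
  simp only [lmul_apply, LinearMap.add_apply, LinearMap.sub_apply, Module.End.mul_apply]
  have h1 := jordan_linearized a b c d
  have h2 := jordan_linearized a b d c
  rw [mul_comm (a * b * c) d, mul_comm c (b * d), mul_comm c (a * d)] at *
  rw [mul_comm (b * d) c, mul_comm d a, mul_comm (a * d) c, mul_comm d c, mul_comm (b * d) (a * c),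
    mul_comm (a * d) (b * c), mul_comm a c] at h2
  rw [mul_comm (b * d) c, mul_comm (a * d) c]
  rw [h1, eq_sub_iff_add_eq, eq_sub_iff_add_eq]
  rw [← sub_eq_zero] at h2 ⊢
  rw [← h2]
  abel

theorem commute_lmul_sq (x : V) : Commute (lmul x) (lmul (x * x)) :=
  LinearMap.ext fun d => DFunLike.congr_fun (commute_lmul_lmul_sq x).eq d

/-- The value of a real polynomial at an element. -/
def evalPoly (x : V) : ℝ[X] →ₗ[ℝ] V :=
  (LinearMap.applyₗ (1 : V)).comp (aeval (lmul x)).toLinearMap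

theorem evalPoly_apply (x : V) (p : ℝ[X]) : evalPoly x p = aeval (lmul x) p 1 := rfl

@[simp] theorem evalPoly_one (x : V) : evalPoly x 1 = 1 := by simp [evalPoly_apply]

@[simp] theorem evalPoly_X (x : V) : evalPoly x X = x := by simp [evalPoly_apply]

@[simp] theorem evalPoly_C (x : V) (a : ℝ) : evalPoly x (C a) = a • (1 : V) := by
  simp [evalPoly_apply, Algebra.algebraMap_eq_smul_one]

theorem evalPoly_X_mul (x : V) (p : ℝ[X]) : evalPoly x (X * p) = x * evalPoly x p := by
  simp [evalPoly_apply]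

/-- The commutative algebra of operators generated by `L(x)` and `L(x²)`. -/
def powerOps (x : V) : Subalgebra ℝ (Module.End ℝ V) :=
  Algebra.adjoin ℝ {lmul x, lmul (x * x)}

theorem lmul_mem_powerOps (x : V) : lmul x ∈ powerOps x :=
  Algebra.subset_adjoin (by simp)

theorem lmul_sq_mem_powerOps (x : V) : lmul (x * x) ∈ powerOps x :=
  Algebra.subset_adjoin (by simp)

theorem commute_of_mem_powerOps {x : V} {T : Module.End ℝ V} (hT : T ∈ powerOps x) :
    Commute (lmul x) T := by
  induction hT using Algebra.adjoin_induction with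
  | mem y hy =>
    rcases hy with rfl | rfl
    · exact Commute.refl _
    · exact commute_lmul_sq x
  | algebraMap r => exact (Algebra.commutes r _).symm
  | add y z _ _ hy hz => exact hy.add_right hz
  | mul y z _ _ hy hz => exact hy.mul_right hz

/-- `lmul_mul_mul` expresses L(xⁿ⁺²) through L(xⁿ) and L(xⁿ⁺¹), so the induction carries two
consecutive powers. -/
theorem lmul_pow_mem (x : V) (n : ℕ) :
    lmul (evalPoly x (X ^ n)) ∈ powerOps x ∧ lmul (evalPoly x (X ^ (n + 1))) ∈ powerOps x := by
  induction n with
  | zero =>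
    constructor
    · rw [pow_zero, evalPoly_one]
      convert (powerOps x).one_mem
      ext; simp
    · simpa using lmul_mem_powerOps x
  | succ n ih =>
    refine ⟨ih.2, ?_⟩
    have h : evalPoly x (X ^ (n + 1 + 1)) = x * evalPoly x (X ^ n) * x := by
      rw [pow_succ', evalPoly_X_mul, pow_succ', evalPoly_X_mul, mul_comm]
    have h' : evalPoly x (X ^ (n + 1)) = x * evalPoly x (X ^ n) := by
      rw [pow_succ', evalPoly_X_mul]
    rw [h, lmul_mul_mul, mul_comm (evalPoly x (X ^ n)) x, ← h']
    have hx := lmul_mem_powerOps x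
    have hx2 := lmul_sq_mem_powerOps x
    exact sub_mem (sub_mem (add_mem (add_mem (mul_mem hx ih.2) (mul_mem ih.1 hx2))
      (mul_mem hx ih.2)) (mul_mem (mul_mem hx hx) ih.1)) (mul_mem (mul_mem ih.1 hx) hx)

theorem lmul_add (x y : V) : lmul (x + y) = lmul x + lmul y := by ext; simp [add_mul]

theorem lmul_smul (r : ℝ) (x : V) : lmul (r • x) = r • lmul x := by
  ext; simp [smul_mul_assoc]

@[simp] theorem lmul_one : lmul (1 : V) = 1 := by ext; simp

theorem commute_lmul_evalPoly (x : V) (p : ℝ[X]) : Commute (lmul x) (lmul (evalPoly x p)) := by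
  induction p using Polynomial.induction_on' with
  | add p q hp hq => rw [map_add, lmul_add]; exact hp.add_right hq
  | monomial n a =>
    rw [← C_mul_X_pow_eq_monomial, ← smul_eq_C_mul, map_smul, lmul_smul]
    exact (commute_of_mem_powerOps (lmul_pow_mem x n).1).smul_right a

/-- Power associativity. -/
theorem evalPoly_mul (x : V) (p q : ℝ[X]) : evalPoly x (p * q) = evalPoly x p * evalPoly x q := by
  -- p(L(x)) commutes with L(q(x)); applying both orders to 1 gives the product rule.
  have h : ∀ q : ℝ[X], Commute (aeval (lmul x) p) (lmul (evalPoly x q)) := fun q => by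
    induction p using Polynomial.induction_on' with
    | add p r hp hr => rw [map_add]; exact hp.add_left hr
    | monomial n a =>
      rw [aeval_monomial]
      exact Commute.mul_left (Algebra.commutes a _) ((commute_lmul_evalPoly x q).pow_left n)
  have := congrArg (fun T : Module.End ℝ V => T 1) (h q).eq
  simp only [Module.End.mul_apply, lmul_apply, mul_one] at this
  rw [mul_comm (evalPoly x p), evalPoly_apply x p, ← this, evalPoly_apply x (p * q), map_mul]
  rfl

theorem inner_mul_left (x y z : V) : inner ℝ (x * y) z = inner ℝ x (y * z) :=
  inner_mul_assoc x y z

theorem inner_mul_right (x y z : V) : inner ℝ x (y * z) = inner ℝ (y * x) z := by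
  rw [mul_comm y x, inner_mul_left]

theorem lmul_isSymmetric (x : V) : (lmul x).IsSymmetric := fun y z => by
  rw [lmul_apply, lmul_apply, inner_mul_right]

theorem tr_eq (x : V) : tr x = inner ℝ x 1 := rfl

theorem tr_mul (x y : V) : tr (x * y) = inner ℝ x y := by
  rw [tr_eq, inner_mul_left, mul_one]

theorem tr_add (x y : V) : tr (x + y) = tr x + tr y := inner_add_left x y 1

theorem tr_sub (x y : V) : tr (x - y) = tr x - tr y := inner_sub_left x y 1

theorem tr_smul (a : ℝ) (x : V) : tr (a • x) = a * tr x := real_inner_smul_left x 1 a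

theorem tr_sum {ι : Type*} (s : Finset ι) (x : ι → V) : tr (∑ i ∈ s, x i) = ∑ i ∈ s, tr (x i) :=
  sum_inner s x 1

/-- L(x) is symmetric, hence diagonalizable, and p(L(x)) = 0 as soon as p vanishes at its
eigenvalues. -/
theorem exists_finset_evalPoly (x : V) :
    ∃ s : Finset ℝ, ∀ p : ℝ[X], (∀ a ∈ s, p.eval a = 0) → evalPoly x p = 0 := by
  have hT := lmul_isSymmetric x
  refine ⟨Finset.univ.image (hT.eigenvalues rfl), fun p hp => ?_⟩
  have : aeval (lmul x) p = 0 := by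
    refine (hT.eigenvectorBasis rfl).toBasis.ext fun i => ?_
    have h := Module.End.aeval_apply_of_hasEigenvector (p := p)
      (hT.hasEigenvector_eigenvectorBasis rfl i)
    rw [OrthonormalBasis.coe_toBasis, h]
    simp [hp]
  rw [evalPoly_apply, this, LinearMap.zero_apply]

namespace IsCSOI

variable {n : ℕ} {c : Fin n → V}

omit [Module ℝ V] [EuclideanJordanAlgebra V] in
theorem mul_eq (hc : IsCSOI c) (i j : Fin n) : c i * c j = if i = j then c i else 0 := by
  split_ifs with h
  · rw [← h, hc.idempotent]
  · exact hc.orthogonal i j h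

theorem mul_sum (hc : IsCSOI c) (l : Fin n → ℝ) (i : Fin n) :
    c i * ∑ j, l j • c j = l i • c i := by
  simp [Finset.mul_sum, mul_smul_comm, hc.mul_eq]

theorem sum_mul_sum (hc : IsCSOI c) (l m : Fin n → ℝ) :
    (∑ i, l i • c i) * ∑ i, m i • c i = ∑ i, (l i * m i) • c i := by
  simp [Finset.sum_mul, smul_mul_assoc, hc.mul_sum, mul_smul]

theorem evalPoly_eq (hc : IsCSOI c) (l : Fin n → ℝ) (p : ℝ[X]) :
    evalPoly (∑ i, l i • c i) p = ∑ i, p.eval (l i) • c i := by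
  induction p using Polynomial.induction_on' with
  | add p q hp hq => simp [hp, hq, add_smul, Finset.sum_add_distrib]
  | monomial k a =>
    rw [← C_mul_X_pow_eq_monomial, ← smul_eq_C_mul, map_smul]
    have : evalPoly (∑ i, l i • c i) (X ^ k) = ∑ i, (l i ^ k) • c i := by
      induction k with
      | zero => simp [hc.complete]
      | succ k ih => rw [pow_succ', evalPoly_X_mul, ih, hc.sum_mul_sum]; simp only [pow_succ']
    rw [this, Finset.smul_sum]
    simp [mul_smul]

theorem exists_poly (l : Fin n → ℝ) {m : ℕ} (l' : Fin m → ℝ) (f : ℝ → ℝ) :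
    ∃ p : ℝ[X], (∀ i, p.eval (l i) = f (l i)) ∧ ∀ i, p.eval (l' i) = f (l' i) := by
  classical
  refine ⟨Lagrange.interpolate (Finset.univ.image l ∪ Finset.univ.image l') id f,
    fun i => ?_, fun i => ?_⟩
  · exact Lagrange.eval_interpolate_at_node f Function.injective_id.injOn (by simp)
  · exact Lagrange.eval_interpolate_at_node f Function.injective_id.injOn (by simp)

end IsCSOI

/-- The idempotents are the Lagrange basis polynomials of the spectrum of L(x), evaluated at x. Some
may vanish, as L(x) can have eigenvalues that x lacks; these are filtered out. -/
theorem exists_isSpectralDecomposition (x : V) :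
    ∃ (n : ℕ) (l : Fin n → ℝ) (c : Fin n → V), IsSpectralDecomposition x l c := by
  classical
  obtain ⟨s, hs⟩ := exists_finset_evalPoly x
  have hs' : ∀ p q : ℝ[X], (∀ a ∈ s, p.eval a = q.eval a) → evalPoly x p = evalPoly x q := by
    intro p q h
    rw [← sub_eq_zero, ← map_sub]
    exact hs _ fun a ha => by simp [h a ha]
  have hb : ∀ a ∈ s, ∀ b ∈ s, (Lagrange.basis s id a).eval b = if a = b then (1 : ℝ) else 0 := by
    intro a ha b hb
    split_ifs with h
    · rw [← h]; exact Lagrange.eval_basis_self Function.injective_id.injOn ha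
    · exact Lagrange.eval_basis_of_ne (v := id) h hb
  set d : ℝ → V := fun a => evalPoly x (Lagrange.basis s id a) with hd
  set t := s.filter (fun a => d a ≠ 0) with ht
  have hsum : ∀ g : ℝ → ℝ, ∑ a ∈ t, g a • d a = ∑ a ∈ s, g a • d a := by
    intro g
    refine Finset.sum_subset (Finset.filter_subset _ _) fun a ha hat => ?_
    have : d a = 0 := by by_contra h; exact hat (Finset.mem_filter.mpr ⟨ha, h⟩)
    simp [this]
  have hsum' : ∀ p : ℝ[X], evalPoly x p = ∑ a ∈ t, p.eval a • d a := by
    intro p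
    rw [hsum]
    simp only [hd, ← map_smul, ← map_sum]
    refine hs' _ _ fun b hbs => ?_
    rw [eval_finsetSum, Finset.sum_eq_single b]
    · simp [hb b hbs b hbs]
    · intro a ha hab
      simp [hb a ha b hbs, hab]
    · exact fun h => absurd hbs h
  let e := t.equivFin
  have hmem : ∀ i, ((e.symm i : t) : ℝ) ∈ s := fun i => (Finset.mem_filter.mp (e.symm i).2).1
  have hre : ∀ g : ℝ → V, ∑ i, g (e.symm i) = ∑ a ∈ t, g a := by
    intro g
    rw [← Finset.sum_coe_sort t g]
    exact Equiv.sum_comp e.symm (fun a : t => g a)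
  refine ⟨t.card, fun i => e.symm i, fun i => d (e.symm i), ⟨⟨?_, ?_, ?_⟩, ?_, ?_, ?_⟩⟩
  · intro i j hij
    have hne : ((e.symm i : t) : ℝ) ≠ e.symm j := fun h =>
      hij (e.symm.injective (Subtype.ext h))
    rw [hd]
    simp only
    rw [← evalPoly_mul]
    refine hs _ fun a ha => ?_
    rw [eval_mul, hb _ (hmem i) a ha, hb _ (hmem j) a ha]
    split_ifs with h1 h2
    · exact absurd (h1.trans h2.symm) hne
    all_goals simp
  · intro i
    rw [hd]
    simp only
    rw [← evalPoly_mul]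
    refine hs' _ _ fun a ha => ?_
    rw [eval_mul, hb _ (hmem i) a ha]
    split_ifs <;> simp
  · rw [hre d, ← evalPoly_one x, hsum' 1]
    simp
  · exact fun i => (Finset.mem_filter.mp (e.symm i).2).2
  · exact Subtype.val_injective.comp e.symm.injective
  · rw [hre (fun a => a • d a)]
    have := hsum' X
    rw [evalPoly_X] at this
    simpa using this

theorem exists_csoi (x : V) :
    ∃ (n : ℕ) (l : Fin n → ℝ) (c : Fin n → V), IsCSOI c ∧ x = ∑ i, l i • c i :=
  let ⟨n, l, c, h⟩ := exists_isSpectralDecomposition x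
  ⟨n, l, c, h.csoi, h.eq_sum⟩

/-- The functional calculus may be computed from any complete system of orthogonal idempotents,
even if eigenvalues are repeated. -/
theorem IsCSOI.apply_eq {n : ℕ} {c : Fin n → V} (hc : IsCSOI c) (f : ℝ → ℝ) (l : Fin n → ℝ) :
    apply f (∑ i, l i • c i) = ∑ i, f (l i) • c i := by
  set x := ∑ i, l i • c i with hx
  have h : ∃ y, IsFunctionValue f x y := by
    obtain ⟨m, l', c', h'⟩ := exists_isSpectralDecomposition x
    exact ⟨_, m, l', c', h', rfl⟩
  rw [apply, dif_pos h]
  obtain ⟨m, l', c', h', hy⟩ := h.choose_spec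
  -- A single polynomial interpolates f on both lists of eigenvalues, so both sums equal p(x).
  obtain ⟨p, hp, hp'⟩ := IsCSOI.exists_poly l l' f
  have h1 := hc.evalPoly_eq l p
  have h2 := h'.csoi.evalPoly_eq l' p
  rw [← h'.eq_sum] at h2
  rw [← hx, h2] at h1
  simp only [hp, hp'] at h1
  rw [hy, h1]

end Algebra

/-! ### Positivity of squares against idempotents. -/

section Positivity

variable {V : Type*} [NonAssocCommRing V] [Module ℝ V] [EuclideanJordanAlgebra V]

/-- The Peirce equation 2L(e)³ - 3L(e)² + L(e) = 0, whose roots are 0, 1/2 and 1. -/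
theorem idempotent_mul {e : V} (he : e * e = e) (v : V) :
    e * v = (3 : ℝ) • (e * (e * v)) - (2 : ℝ) • (e * (e * (e * v))) := by
  have h := DFunLike.congr_fun (lmul_mul_mul e e e) v
  simp only [he, lmul_apply, LinearMap.add_apply, LinearMap.sub_apply, Module.End.mul_apply] at h
  linear_combination (norm := module) h

/-- On the Peirce spectrum {0, 1/2, 1} one has t = t² + 4(t² - t)², which displays L(e) as a sum of
squares of symmetric operators. -/
theorem inner_mul_self_of_idempotent {e : V} (he : e * e = e) (v : V) :
    inner ℝ (e * v) v = ‖e * v‖ ^ 2 + 4 * ‖e * (e * v) - e * v‖ ^ 2 := by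
  have h1 := idempotent_mul he v
  set a := e * v with ha
  have h0 : ∀ x y, inner ℝ (e * x) y = inner ℝ x (e * y) := fun x y => by
    rw [inner_mul_right, mul_comm]
  have key : ∀ w, inner ℝ a w = 3 * inner ℝ a (e * w) - 2 * inner ℝ a (e * (e * w)) := fun w => by
    have h2 := congrArg (fun z => inner ℝ z w) h1
    simp only [inner_sub_left, real_inner_smul_left] at h2
    rwa [h0 a w, h0 (e * a) w, h0 a (e * w)] at h2
  have h2 := key v
  have h3 := key a
  rw [← ha] at h2
  rw [← h0 a (e * a)] at h3
  rw [norm_sub_sq_real, ← real_inner_self_eq_norm_sq, ← real_inner_self_eq_norm_sq, h2,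
    real_inner_comm a (e * a)]
  linarith

theorem inner_sq_idempotent {e : V} (he : e * e = e) (v : V) :
    inner ℝ (v * v) e = ‖e * v‖ ^ 2 + 4 * ‖e * (e * v) - e * v‖ ^ 2 := by
  rw [← inner_mul_self_of_idempotent he, inner_mul_left, real_inner_comm, mul_comm]

theorem inner_idempotent_nonneg {x e : V} (hx : x ∈ squareCone V) (he : e * e = e) :
    0 ≤ inner ℝ x e := by
  obtain ⟨v, rfl⟩ := hx
  rw [inner_sq_idempotent he]
  positivity

theorem mul_eq_zero_of_inner_eq_zero {e v : V} (he : e * e = e) (h : inner ℝ (v * v) e = 0) :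
    e * v = 0 := by
  rw [inner_sq_idempotent he] at h
  have h1 : ‖e * v‖ ^ 2 = 0 := by nlinarith [sq_nonneg ‖e * v‖, sq_nonneg ‖e * (e * v) - e * v‖]
  simpa using h1

theorem tr_idempotent {e : V} (he : e * e = e) : tr e = ‖e‖ ^ 2 := by
  rw [← real_inner_self_eq_norm_sq, ← tr_mul, he]

theorem tr_idempotent_nonneg {e : V} (he : e * e = e) : 0 ≤ tr e := by
  rw [tr_idempotent he]; positivity

omit [Module ℝ V] [EuclideanJordanAlgebra V] in
theorem mem_squareCone_of_idempotent {e : V} (he : e * e = e) : e ∈ squareCone V := ⟨e, he.symm⟩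

namespace IsCSOI

variable {n : ℕ} {c : Fin n → V}

theorem tr_apply (hc : IsCSOI c) (f : ℝ → ℝ) (l : Fin n → ℝ) :
    tr (apply f (∑ i, l i • c i)) = ∑ i, f (l i) * tr (c i) := by
  simp [hc.apply_eq, tr_sum, tr_smul]

theorem sum_tr (hc : IsCSOI c) : ∑ i, tr (c i) = tr (1 : V) := by
  rw [← tr_sum, hc.complete]

theorem inner_sum (hc : IsCSOI c) (l : Fin n → ℝ) (i : Fin n) :
    inner ℝ (∑ j, l j • c j) (c i) = l i * tr (c i) := by
  rw [← tr_mul, mul_comm, hc.mul_sum, tr_smul]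

theorem sum_mem_squareCone (hc : IsCSOI c) {l : Fin n → ℝ} (hl : ∀ i, 0 ≤ l i) :
    ∑ i, l i • c i ∈ squareCone V := by
  refine ⟨∑ i, √(l i) • c i, ?_⟩
  rw [hc.sum_mul_sum]
  simp [hl]

theorem sum_finset_idempotent (hc : IsCSOI c) (s : Finset (Fin n)) :
    (∑ i ∈ s, c i) * ∑ i ∈ s, c i = ∑ i ∈ s, c i := by
  classical
  have : ∑ i ∈ s, c i = ∑ i, (if i ∈ s then (1 : ℝ) else 0) • c i := by simp [ite_smul]
  rw [this, hc.sum_mul_sum]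
  simp

theorem norm_sum_le (hc : IsCSOI c) {l : Fin n → ℝ} {M : ℝ} (hl : ∀ i, |l i| ≤ M) :
    ‖∑ i, l i • c i‖ ^ 2 ≤ M ^ 2 * tr (1 : V) := by
  rw [← real_inner_self_eq_norm_sq, ← tr_mul, hc.sum_mul_sum, tr_sum, ← hc.sum_tr,
    Finset.mul_sum]
  refine Finset.sum_le_sum fun i _ => ?_
  rw [tr_smul, ← pow_two, ← sq_abs]
  have := tr_idempotent_nonneg (hc.idempotent i)
  gcongr
  exact hl i

end IsCSOI

namespace IsSpectralDecomposition

variable {n : ℕ} {l : Fin n → ℝ} {c : Fin n → V} {x : V}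

theorem tr_pos (h : IsSpectralDecomposition x l c) (i : Fin n) : 0 < tr (c i) := by
  rw [tr_idempotent (h.csoi.idempotent i)]
  have := norm_pos_iff.mpr (h.ne_zero i)
  positivity

theorem nonneg_of_inner (h : IsSpectralDecomposition x l c) {i : Fin n}
    (hx : 0 ≤ inner ℝ x (c i)) : 0 ≤ l i := by
  rw [h.eq_sum, h.csoi.inner_sum] at hx
  exact nonneg_of_mul_nonneg_left hx (h.tr_pos i)

theorem nonneg (h : IsSpectralDecomposition x l c) (hx : x ∈ squareCone V) (i : Fin n) :
    0 ≤ l i :=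
  h.nonneg_of_inner (inner_idempotent_nonneg hx (h.csoi.idempotent i))

theorem mul_eq (h : IsSpectralDecomposition x l c) (i : Fin n) : x * c i = l i • c i := by
  rw [h.eq_sum, mul_comm, h.csoi.mul_sum]

/-- The eigenvalues are bounded by the norm of the multiplication operator. -/
theorem abs_le (h : IsSpectralDecomposition x l c) {M : ℝ} (hM : ∀ v, ‖x * v‖ ≤ M * ‖v‖)
    (i : Fin n) : |l i| ≤ M := by
  have h1 := hM (c i)
  rw [h.mul_eq, norm_smul, Real.norm_eq_abs] at h1
  exact le_of_mul_le_mul_right h1 (norm_pos_iff.mpr (h.ne_zero i))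

end IsSpectralDecomposition

end Positivity

/-! ### The quadratic representation. -/

section Quadratic

variable {V : Type*} [NonAssocCommRing V] [Module ℝ V] [EuclideanJordanAlgebra V]

/-- The quadratic representation `P(x) = 2 L(x)² - L(x²)`. -/
def quad (x : V) : Module.End ℝ V := (2 : ℝ) • (lmul x * lmul x) - lmul (x * x)

@[simp] theorem quad_one : quad (1 : V) = 1 := by
  rw [quad, mul_one, lmul_one, mul_one, two_smul, add_sub_cancel_right]

/-- The infinitesimal form of the fundamental formula. -/
theorem quad_mul (b x : V) :
    (2 : ℝ) • (lmul (b * x) * lmul x + lmul x * lmul (b * x) - lmul (b * x * x)) =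
      lmul b * quad x + quad x * lmul b := by
  have h1 := lmul_mul_mul b x x
  have h2 := lmul_jordan x x b
  rw [mul_comm x b] at h1 h2
  simp only [quad, h1, mul_sub, sub_mul, smul_sub, smul_add, mul_smul_comm, smul_mul_assoc,
    mul_assoc]
  simp only [← mul_assoc] at h2 ⊢
  linear_combination (norm := module) (-1 : ℝ) • h2

theorem quad_sq (x : V) : quad (x * x) = quad x * quad x := by
  have h3 := lmul_mul_mul x x x
  have h4 := lmul_mul_mul x x (x * x)
  have hc := (commute_lmul_sq x).eq
  rw [mul_comm x (x * x), h3] at h4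
  simp only [quad, h4]
  set A := lmul x
  set B := lmul (x * x)
  have hc' : ∀ T, A * (B * T) = B * (A * T) := fun T => by rw [← mul_assoc, hc, mul_assoc]
  simp only [mul_sub, sub_mul, mul_add, smul_sub, mul_smul_comm, smul_mul_assoc, mul_assoc, hc,
    hc']
  module

theorem quad_csoi_apply {n : ℕ} {c : Fin n → V} (hc : IsCSOI c) (l : Fin n → ℝ) (i : Fin n) :
    quad (∑ j, l j • c j) (c i) = (l i * l i) • c i := by
  simp only [quad, LinearMap.sub_apply, LinearMap.smul_apply, Module.End.mul_apply, lmul_apply,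
    hc.sum_mul_sum]
  rw [mul_comm _ (c i), hc.mul_sum, mul_comm _ (l i • c i), smul_mul_assoc, hc.mul_sum,
    mul_comm _ (c i), hc.mul_sum]
  module

end Quadratic

theorem exists_bilinear_bound {E : Type*} [NormedAddCommGroup E] [NormedSpace ℝ E]
    [FiniteDimensional ℝ E] (B : E →ₗ[ℝ] E →ₗ[ℝ] E) :
    ∃ C : ℝ, 0 ≤ C ∧ ∀ x y : E, ‖B x y‖ ≤ C * ‖x‖ * ‖y‖ :=
  ⟨‖B.toContinuousBilinearMap‖, norm_nonneg _, B.toContinuousBilinearMap.le_opNorm₂⟩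

theorem hasDerivAt_bilinear {E : Type*} [NormedAddCommGroup E] [NormedSpace ℝ E]
    [FiniteDimensional ℝ E] (B : E →ₗ[ℝ] E →ₗ[ℝ] E) {x y : ℝ → E} {x' y' : E} {s : ℝ}
    (hx : HasDerivAt x x' s) (hy : HasDerivAt y y' s) :
    HasDerivAt (fun s => B (x s) (y s)) (B x' (y s) + B (x s) y') s := by
  rw [add_comm]
  exact B.toContinuousBilinearMap.hasDerivAt_of_bilinear (fun _ => hx) (fun _ => hy)

/-! ### Derivatives of traces of spectral functions along a curve. -/

section Derivative

variable {V : Type*} [NonAssocCommRing V] [Module ℝ V] [EuclideanJordanAlgebra V]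

theorem hasDerivAt_mul {x y : ℝ → V} {x' y' : V} {s : ℝ} (hx : HasDerivAt x x' s)
    (hy : HasDerivAt y y' s) : HasDerivAt (fun s => x s * y s) (x' * y s + x s * y') s := by
  exact hasDerivAt_bilinear (LinearMap.mul ℝ V) hx hy

theorem exists_norm_mul_le : ∃ C : ℝ, 0 ≤ C ∧ ∀ x y : V, ‖x * y‖ ≤ C * ‖x‖ * ‖y‖ :=
  exists_bilinear_bound (LinearMap.mul ℝ V)

/-- Without associativity the derivative of xⁿ is not n xⁿ⁻¹x', but its pairing with powers of x
behaves as if it were. Quantifying over k lets the induction absorb a factor x. At n = 0 the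
truncated subtraction is harmless because of the factor n. -/
theorem exists_hasDerivAt_evalPoly_pow {x : ℝ → V} {x' : V} {s : ℝ} (hx : HasDerivAt x x' s)
    (n : ℕ) :
    ∃ d : V, HasDerivAt (fun s => evalPoly (x s) (X ^ n)) d s ∧
      ∀ k : ℕ, inner ℝ (evalPoly (x s) (X ^ k)) d =
        n * inner ℝ (evalPoly (x s) (X ^ (k + n - 1))) x' := by
  induction n with
  | zero => exact ⟨0, by simpa using hasDerivAt_const s (1 : V), by simp⟩
  | succ n ih =>
    obtain ⟨d, hd, hk⟩ := ih
    refine ⟨x' * evalPoly (x s) (X ^ n) + x s * d, ?_, fun k => ?_⟩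
    · simpa only [pow_succ', evalPoly_X_mul] using hasDerivAt_mul hx hd
    · rw [inner_add_right, inner_mul_right (evalPoly (x s) (X ^ k)) (x s), ← evalPoly_X_mul,
        ← pow_succ', hk, mul_comm x', inner_mul_right, ← evalPoly_mul, ← pow_add, add_comm n k]
      have h1 : k + 1 + n - 1 = k + n := by omega
      have h2 : k + (n + 1) - 1 = k + n := by omega
      rw [h1, h2]
      push_cast
      ring

theorem hasDerivAt_tr_evalPoly {x : ℝ → V} {x' : V} {s : ℝ} (hx : HasDerivAt x x' s)
    (p : ℝ[X]) : HasDerivAt (fun s => tr (evalPoly (x s) p))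
      (inner ℝ (evalPoly (x s) (derivative p)) x') s := by
  induction p using Polynomial.induction_on' with
  | add p q hp hq =>
    simp only [map_add, tr_add, inner_add_left]
    exact hp.add hq
  | monomial n a =>
    obtain ⟨d, hd, hk⟩ := exists_hasDerivAt_evalPoly_pow hx n
    have h0 := hk 0
    rw [pow_zero, evalPoly_one, zero_add] at h0
    rw [derivative_monomial]
    simp only [← C_mul_X_pow_eq_monomial, ← smul_eq_C_mul, map_smul, tr_smul,
      real_inner_smul_left, mul_assoc]
    rw [← h0]
    refine HasDerivAt.const_mul a ?_
    simp only [tr_eq]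
    have := hd.inner ℝ (hasDerivAt_const s (1 : V))
    rw [real_inner_comm]
    simpa using this

theorem apply_eval (x : V) (p : ℝ[X]) : apply (fun u => p.eval u) x = evalPoly x p := by
  obtain ⟨n, l, c, hc, rfl⟩ := exists_csoi x
  rw [hc.apply_eq, hc.evalPoly_eq]

theorem apply_sub (x : V) (f g : ℝ → ℝ) :
    apply (fun u => f u - g u) x = apply f x - apply g x := by
  obtain ⟨n, l, c, hc, rfl⟩ := exists_csoi x
  simp only [hc.apply_eq, sub_smul, Finset.sum_sub_distrib]

theorem mul_apply_eq (x : V) (g : ℝ → ℝ) : x * apply g x = apply (fun u => u * g u) x := by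
  obtain ⟨n, l, c, hc, rfl⟩ := exists_csoi x
  rw [hc.apply_eq, hc.apply_eq, hc.sum_mul_sum]

theorem apply_congr {x : V} {f g : ℝ → ℝ} {n : ℕ} {l : Fin n → ℝ} {c : Fin n → V}
    (h : IsSpectralDecomposition x l c) (hfg : ∀ i, f (l i) = g (l i)) :
    apply f x = apply g x := by
  rw [h.eq_sum, h.csoi.apply_eq, h.csoi.apply_eq]
  simp [hfg]

theorem apply_const (x : V) (k : ℝ) : apply (fun _ => k) x = k • (1 : V) := by
  simpa using apply_eval x (C k)

theorem tr_one_nonneg : 0 ≤ tr (1 : V) := tr_idempotent_nonneg (mul_one 1)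

theorem norm_apply_le {x : V} {M ε : ℝ} (hM : ∀ v, ‖x * v‖ ≤ M * ‖v‖) (hε : 0 ≤ ε) {h : ℝ → ℝ}
    (hh : ∀ u, |u| ≤ M → |h u| ≤ ε) : ‖apply h x‖ ≤ ε * √(tr (1 : V)) := by
  obtain ⟨n, l, c, hx⟩ := exists_isSpectralDecomposition x
  rw [hx.eq_sum, hx.csoi.apply_eq]
  have := hx.csoi.norm_sum_le (l := fun i => h (l i)) (M := ε) fun i => hh _ (hx.abs_le hM i)
  refine le_of_sq_le_sq ?_ (by positivity)
  rwa [mul_pow, Real.sq_sqrt tr_one_nonneg]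

theorem abs_tr_apply_le {x : V} {M ε : ℝ} (hM : ∀ v, ‖x * v‖ ≤ M * ‖v‖) (hε : 0 ≤ ε)
    {h : ℝ → ℝ} (hh : ∀ u, |u| ≤ M → |h u| ≤ ε) : |tr (apply h x)| ≤ ε * tr (1 : V) := by
  rw [tr_eq]
  refine (abs_real_inner_le_norm _ _).trans ?_
  have h1 := norm_apply_le hM hε hh
  have h2 : ‖(1 : V)‖ = √(tr (1 : V)) := by
    rw [tr_idempotent (mul_one 1), Real.sqrt_sq (norm_nonneg _)]
  calc ‖apply h x‖ * ‖(1 : V)‖ ≤ ε * √(tr (1 : V)) * √(tr (1 : V)) := by rw [h2]; gcongr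
    _ = ε * tr (1 : V) := by rw [mul_assoc, Real.mul_self_sqrt tr_one_nonneg]

theorem exists_derivative_eq (q : ℝ[X]) (a : ℝ) : ∃ p : ℝ[X], derivative p = q ∧ p.eval 0 = a := by
  have h : ∃ p : ℝ[X], derivative p = q := by
    induction q using Polynomial.induction_on' with
    | add p q hp hq =>
      obtain ⟨p', hp⟩ := hp
      obtain ⟨q', hq⟩ := hq
      exact ⟨p' + q', by rw [derivative_add, hp, hq]⟩
    | monomial n a =>
      refine ⟨monomial (n + 1) (a / (n + 1)), ?_⟩
      rw [derivative_monomial]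
      push_cast
      rw [div_mul_cancel₀ _ (by positivity)]
  obtain ⟨p, hp⟩ := h
  exact ⟨p + C (a - p.eval 0), by simp [hp], by simp⟩

/-- Approximation of a continuously differentiable function by polynomials, together with its
derivative. -/
theorem exists_poly_near {f g : ℝ → ℝ} (hf : ∀ u, HasDerivAt f (g u) u) (hg : Continuous g)
    {M ε : ℝ} (hM : 0 ≤ M) (hε : 0 < ε) :
    ∃ p : ℝ[X], ∀ u, |u| ≤ M →
      |(derivative p).eval u - g u| ≤ ε ∧ |p.eval u - f u| ≤ ε * M := by
  obtain ⟨q, hq⟩ := exists_polynomial_near_of_continuousOn (-M) M g hg.continuousOn ε hε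
  obtain ⟨p, hp, hp0⟩ := exists_derivative_eq q (f 0)
  refine ⟨p, fun u hu => ?_⟩
  have hu' := abs_le.mp hu
  refine ⟨by rw [hp]; exact (hq u hu').le, ?_⟩
  have h := Convex.norm_image_sub_le_of_norm_hasDerivWithin_le (s := Set.Icc (-M) M)
    (f := fun u => p.eval u - f u) (f' := fun u => q.eval u - g u) (C := ε) (x := 0) (y := u)
    (fun v _ => (hp ▸ (p.hasDerivAt v).sub (hf v)).hasDerivWithinAt)
    (fun v hv => (hq v hv).le) (convex_Icc _ _) ⟨by linarith, hM⟩ hu'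
  simp only [hp0, sub_self, sub_zero, Real.norm_eq_abs] at h
  exact h.trans (by gcongr)

/-- For polynomials the trace is differentiable with derivative ⟨p'(x), x'⟩. Approximating f and g
together by p and p' on [-M, M], the mean value inequality bounds the defect by a multiple of ε. -/
theorem tr_apply_sub_eq {x x' : ℝ → V} {T : ℝ} (hT : 0 ≤ T) (hx : ∀ s, HasDerivAt x (x' s) s)
    {B M k : ℝ} (hB : ∀ s ∈ Set.Icc 0 T, ‖x' s‖ ≤ B)
    (hM0 : 0 ≤ M) (hM : ∀ s ∈ Set.Icc 0 T, ∀ v, ‖x s * v‖ ≤ M * ‖v‖)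
    {f g : ℝ → ℝ} (hf : ∀ u, HasDerivAt f (g u) u) (hg : Continuous g)
    (hk : ∀ s ∈ Set.Icc 0 T, inner ℝ (apply g (x s)) (x' s) = k) :
    tr (apply f (x T)) - tr (apply f (x 0)) = k * T := by
  have hB0 : 0 ≤ B := (norm_nonneg _).trans (hB 0 ⟨le_rfl, hT⟩)
  set D := √(tr (1 : V)) * B * T + 2 * M * tr (1 : V) with hD
  have hD0 : 0 ≤ D := by have := tr_one_nonneg (V := V); positivity
  have main : ∀ ε > 0, |tr (apply f (x T)) - tr (apply f (x 0)) - k * T| ≤ ε * D := by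
    intro ε hε
    obtain ⟨p, hp⟩ := exists_poly_near hf hg hM0 hε
    have h1 : ∀ s ∈ Set.Icc 0 T, |tr (evalPoly (x s) p) - tr (apply f (x s))| ≤
        ε * M * tr (1 : V) := fun s hs => by
      rw [← tr_sub, ← apply_eval, ← apply_sub]
      exact abs_tr_apply_le (hM s hs) (by positivity) fun u hu => (hp u hu).2
    have h2 : |(tr (evalPoly (x T) p) - k * T) - (tr (evalPoly (x 0) p) - k * 0)| ≤
        ε * √(tr (1 : V)) * B * |T - 0| := by
      refine Convex.norm_image_sub_le_of_norm_hasDerivWithin_le (s := Set.Icc 0 T)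
        (f := fun s => tr (evalPoly (x s) p) - k * s)
        (f' := fun s => inner ℝ (evalPoly (x s) (derivative p)) (x' s) - k)
        (fun s _ => ?_) (fun s hs => ?_) (convex_Icc _ _) ⟨le_rfl, hT⟩ ⟨hT, le_rfl⟩
      · have := (hasDerivAt_id s).const_mul k
        rw [mul_one] at this
        exact ((hasDerivAt_tr_evalPoly (hx s) p).sub this).hasDerivWithinAt
      · rw [← hk s hs, ← inner_sub_left, ← apply_eval, ← apply_sub, Real.norm_eq_abs]
        refine (abs_real_inner_le_norm _ _).trans ?_
        have := norm_apply_le (hM s hs) hε.le fun u hu => (hp u hu).1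
        have := hB s hs
        gcongr
    rw [sub_zero, abs_of_nonneg hT] at h2
    have h3 := abs_le.mp (h1 T ⟨hT, le_rfl⟩)
    have h4 := abs_le.mp (h1 0 ⟨le_rfl, hT⟩)
    have h5 := abs_le.mp h2
    have h6 : ε * D = ε * √(tr (1 : V)) * B * T + 2 * (ε * M * tr (1 : V)) := by rw [hD]; ring
    rw [h6, abs_le]
    constructor <;> linarith
  have : tr (apply f (x T)) - tr (apply f (x 0)) - k * T = 0 := by
    by_contra hne
    have hpos := abs_pos.mpr hne
    have := main _ (div_pos hpos (by positivity : (0 : ℝ) < 2 * (D + 1)))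
    rw [div_mul_eq_mul_div, le_div_iff₀ (by positivity)] at this
    nlinarith
  linarith

end Derivative

/-! ### One-parameter groups of linear maps. -/

section ExpFlow

variable {E : Type*} [NormedAddCommGroup E] [NormedSpace ℝ E] [FiniteDimensional ℝ E]

/-- The one-parameter group generated by an endomorphism. -/
def expFlow (A : E →ₗ[ℝ] E) (s : ℝ) : E →ₗ[ℝ] E :=
  (NormedSpace.exp (s • LinearMap.toContinuousLinearMap A) : E →L[ℝ] E).toLinearMap

theorem hasDerivAt_expFlow (A : E →ₗ[ℝ] E) (v : E) (s : ℝ) :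
    HasDerivAt (fun s => expFlow A s v) (A (expFlow A s v)) s := by
  have : CompleteSpace E := FiniteDimensional.complete ℝ E
  have h := hasDerivAt_exp_smul_const' (𝕂 := ℝ) (LinearMap.toContinuousLinearMap A) s
  have h2 := h.clm_apply (hasDerivAt_const s v)
  refine h2.congr_deriv ?_
  rw [map_zero, add_zero]
  rfl

theorem expFlow_zero (A : E →ₗ[ℝ] E) (v : E) : expFlow A 0 v = v := by
  simp [expFlow]

theorem expFlow_neg (A : E →ₗ[ℝ] E) (v : E) (s : ℝ) : expFlow A s (expFlow A (-s) v) = v := by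
  have : CompleteSpace E := FiniteDimensional.complete ℝ E
  set B := LinearMap.toContinuousLinearMap A
  let _ : NormedAlgebra ℚ (E →L[ℝ] E) := NormedAlgebra.restrictScalars ℚ ℝ _
  have h : NormedSpace.exp (s • B) * NormedSpace.exp ((-s) • B) = 1 := by
    rw [← NormedSpace.exp_add_of_commute (((Commute.refl B).smul_left s).smul_right (-s))]
    simp
  exact DFunLike.congr_fun h v

theorem exists_norm_expFlow_le (A : E →ₗ[ℝ] E) :
    ∃ K : ℝ, 0 < K ∧ ∀ s ∈ Set.Icc (-1 : ℝ) 1, ∀ v, ‖expFlow A s v‖ ≤ K * ‖v‖ := by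
  have : CompleteSpace E := FiniteDimensional.complete ℝ E
  set B := LinearMap.toContinuousLinearMap A
  have hcont : Continuous (fun s : ℝ => NormedSpace.exp (s • B)) :=
    continuous_iff_continuousAt.mpr fun s =>
      (hasDerivAt_exp_smul_const' (𝕂 := ℝ) B s).continuousAt
  obtain ⟨K, hK⟩ := isCompact_Icc.exists_bound_of_continuousOn
    (s := Set.Icc (-1 : ℝ) 1) hcont.continuousOn
  exact ⟨max K 1, by positivity, fun s hs v =>
    ((NormedSpace.exp (s • B)).le_opNorm v).trans
      (by gcongr; exact (hK s hs).trans (le_max_left _ _))⟩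

end ExpFlow

/-! ### Cone automorphisms exp(2sL(b)), the fundamental formula and the law of inertia. -/

section Flow

variable {V : Type*} [NonAssocCommRing V] [Module ℝ V] [EuclideanJordanAlgebra V]

/-- The one-parameter group `exp(2 s L(b))` of automorphisms of the cone. -/
def flow (b : V) (s : ℝ) : V →ₗ[ℝ] V := expFlow ((2 : ℝ) • lmul b) s

theorem hasDerivAt_flow (b v : V) (s : ℝ) :
    HasDerivAt (fun s => flow b s v) ((2 : ℝ) • (b * flow b s v)) s :=
  hasDerivAt_expFlow ((2 : ℝ) • lmul b) v s

@[simp] theorem flow_zero (b v : V) : flow b 0 v = v := expFlow_zero _ v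

theorem flow_flow_neg (b v : V) (s : ℝ) : flow b s (flow b (-s) v) = v := expFlow_neg _ v s

theorem flow_neg_flow (b v : V) (s : ℝ) : flow b (-s) (flow b s v) = v := by
  simpa using flow_flow_neg b v (-s)

theorem hasDerivAt_flow_neg (b v : V) (s : ℝ) :
    HasDerivAt (fun s => flow b (-s) v) ((-2 : ℝ) • (b * flow b (-s) v)) s := by
  have h := HasDerivAt.scomp s (hasDerivAt_flow b v (-s)) (hasDerivAt_neg s)
  simpa [Function.comp_def, neg_smul] using h

theorem eq_of_hasDerivAt_zero {f : ℝ → ℝ} (hf : ∀ s, HasDerivAt f 0 s) (s t : ℝ) : f s = f t :=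
  is_const_of_deriv_eq_zero (fun s => (hf s).differentiableAt) (fun s => (hf s).deriv) s t

theorem inner_mul_comm (b v w : V) : inner ℝ (b * v) w = inner ℝ v (b * w) :=
  lmul_isSymmetric b v w

theorem inner_flow_flow_neg (b v w : V) (s : ℝ) :
    inner ℝ (flow b s v) (flow b (-s) w) = inner ℝ v w := by
  have h : ∀ s, HasDerivAt (fun s => inner ℝ (flow b s v) (flow b (-s) w)) (0 : ℝ) s := by
    intro s
    refine HasDerivAt.congr_deriv ((hasDerivAt_flow b v s).inner ℝ (hasDerivAt_flow_neg b w s)) ?_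
    rw [real_inner_smul_left, real_inner_smul_right, inner_mul_comm]
    ring
  simpa using eq_of_hasDerivAt_zero h s 0

theorem inner_flow_neg (b v w : V) (s : ℝ) :
    inner ℝ (flow b (-s) v) w = inner ℝ v (flow b (-s) w) := by
  rw [← inner_flow_flow_neg b (flow b (-s) v) w s, flow_flow_neg]

theorem hasDerivAt_quad {x p : ℝ → V} {x' p' : V} {s : ℝ} (hx : HasDerivAt x x' s)
    (hp : HasDerivAt p p' s) :
    HasDerivAt (fun s => quad (x s) (p s))
      ((2 : ℝ) • (x' * (x s * p s) + x s * (x' * p s) - x' * x s * p s) + quad (x s) p') s := by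
  have h1 := hasDerivAt_mul hx (hasDerivAt_mul hx hp)
  have h2 := hasDerivAt_mul (hasDerivAt_mul hx hx) hp
  have h3 := (h1.const_smul (2 : ℝ)).sub h2
  refine h3.congr_deriv ?_
  simp only [quad, LinearMap.sub_apply, LinearMap.smul_apply, Module.End.mul_apply, lmul_apply,
    mul_add, add_mul, mul_comm (x s) x']
  module

/-- The fundamental formula `P(Γ z) = Γ P(z) Γ` for the flow `Γ`. -/
theorem inner_quad_flow (b z v w : V) (s : ℝ) :
    inner ℝ (quad (flow b s z) (flow b (-s) v)) (flow b (-s) w) = inner ℝ (quad z v) w := by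
  have h : ∀ s, HasDerivAt
      (fun s => inner ℝ (quad (flow b s z) (flow b (-s) v)) (flow b (-s) w)) (0 : ℝ) s := by
    intro s
    refine HasDerivAt.congr_deriv
      ((hasDerivAt_quad (hasDerivAt_flow b z s) (hasDerivAt_flow_neg b v s)).inner ℝ
      (hasDerivAt_flow_neg b w s)) ?_
    have h1 := DFunLike.congr_fun (quad_mul b (flow b s z)) (flow b (-s) v)
    simp only [LinearMap.sub_apply, LinearMap.add_apply, LinearMap.smul_apply,
      Module.End.mul_apply, lmul_apply] at h1
    generalize flow b s z = x at *
    generalize flow b (-s) v = p at *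
    generalize flow b (-s) w = q at *
    have h2 : (2 : ℝ) • ((2 : ℝ) • (b * x) * (x * p) + x * ((2 : ℝ) • (b * x) * p) -
        (2 : ℝ) • (b * x) * x * p) + quad x ((-2 : ℝ) • (b * p)) = (2 : ℝ) • (b * quad x p) := by
      simp only [smul_mul_assoc, mul_smul_comm, map_smul]
      linear_combination (norm := module) (2 : ℝ) • h1
    rw [h2, real_inner_smul_left, real_inner_smul_right, inner_mul_comm]
    ring
  simpa using eq_of_hasDerivAt_zero h s 0

theorem flow_csoi {n : ℕ} {c : Fin n → V} (hc : IsCSOI c) (β : Fin n → ℝ) (s : ℝ) (i : Fin n) :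
    flow (∑ j, β j • c j) s (c i) = Real.exp (2 * s * β i) • c i := by
  set b := ∑ j, β j • c j with hb
  have hbc : b * c i = β i • c i := by rw [mul_comm, hb, hc.mul_sum]
  suffices h : flow b (-s) (Real.exp (2 * s * β i) • c i) = c i by
    conv_lhs => rw [← h, flow_flow_neg]
  refine ext_inner_right ℝ fun w => ?_
  have h : ∀ s, HasDerivAt (fun s => inner ℝ (Real.exp (2 * s * β i) • c i) (flow b (-s) w))
      (0 : ℝ) s := by
    intro s
    have h1 : HasDerivAt (fun s => Real.exp (2 * s * β i))
        (Real.exp (2 * s * β i) * (2 * β i)) s := by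
      have := (((hasDerivAt_id s).const_mul 2).mul_const (β i)).exp
      simpa using this
    refine HasDerivAt.congr_deriv ((h1.smul_const (c i)).inner ℝ (hasDerivAt_flow_neg b w s)) ?_
    rw [real_inner_smul_left, real_inner_smul_right, ← inner_mul_comm, hbc, real_inner_smul_left,
      real_inner_smul_left]
    ring
  rw [inner_flow_neg]
  simpa using eq_of_hasDerivAt_zero h s 0

theorem flow_one {n : ℕ} {c : Fin n → V} (hc : IsCSOI c) (β : Fin n → ℝ) (s : ℝ) :
    flow (∑ j, β j • c j) s 1 = ∑ i, Real.exp (2 * s * β i) • c i := by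
  conv_lhs => rw [← hc.complete, map_sum]
  exact Finset.sum_congr rfl fun i _ => flow_csoi hc β s i

/-- With b = ∑ log|lᵢ| cᵢ one has z² = Γ1, so the fundamental formula at 1 reads ⟨P(z²)u, u⟩ =
‖Γu‖². Since P(z²) = P(z)², a kernel vector of P(z) is killed by Γ. -/
theorem quad_injective {n : ℕ} {c : Fin n → V} (hc : IsCSOI c) {l : Fin n → ℝ}
    (hl : ∀ i, l i ≠ 0) : Function.Injective (quad (∑ i, l i • c i)) := by
  rw [injective_iff_map_eq_zero]
  intro u hu
  set z := ∑ i, l i • c i with hz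
  have hzz : z * z = flow (∑ i, Real.log (l i) • c i) 1 1 := by
    rw [flow_one hc, hz, hc.sum_mul_sum]
    refine Finset.sum_congr rfl fun i _ => ?_
    rw [mul_one, two_mul, Real.exp_add, Real.exp_log_eq_abs (hl i), abs_mul_abs_self]
  have hu2 : quad (z * z) u = 0 := by rw [quad_sq, Module.End.mul_apply, hu, map_zero]
  set b := ∑ i, Real.log (l i) • c i
  have h := inner_quad_flow b 1 (flow b 1 u) (flow b 1 u) 1
  rw [flow_neg_flow, ← hzz, hu2, inner_zero_left, quad_one, Module.End.one_apply, eq_comm,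
    inner_self_eq_zero] at h
  rw [← flow_neg_flow b u 1, h, map_zero]

theorem exists_norm_flow_le (b : V) :
    ∃ K : ℝ, 0 < K ∧ ∀ s ∈ Set.Icc (-1 : ℝ) 1, ∀ v, ‖flow b s v‖ ≤ K * ‖v‖ :=
  exists_norm_expFlow_le _

/-- Along the flow of an invertible element, the eigenvalues stay away from zero. -/
theorem exists_eigenvalue_gap (b : V) {z : V} (hz : Function.Injective (quad z)) :
    ∃ δ : ℝ, 0 < δ ∧ ∀ s ∈ Set.Icc (0 : ℝ) 1, ∀ (n : ℕ) (l : Fin n → ℝ) (c : Fin n → V),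
      IsSpectralDecomposition (flow b s z) l c → ∀ i, δ ≤ |l i| := by
  obtain ⟨K, hK, hflow⟩ := exists_norm_flow_le b
  obtain ⟨C, hC, hanti⟩ := (quad z).injective_iff_antilipschitz.mp hz
  have hC' : (0 : ℝ) < C := hC
  have hquad : ∀ v, ‖v‖ ≤ C * ‖quad z v‖ := fun v => by
    simpa using hanti.le_mul_dist v 0
  -- For v = Γₛcᵢ and w = P(z)v, the fundamental formula gives ‖w‖² = lᵢ²⟨cᵢ, Γ₋ₛw⟩, hence ‖w‖ ≤
  -- lᵢ²K‖cᵢ‖. With ‖cᵢ‖ ≤ KC‖w‖ this yields 1 ≤ lᵢ²K²C.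
  refine ⟨√(1 / (K ^ 2 * C)), by positivity, fun s hs n l c hx i => ?_⟩
  rw [← Real.sqrt_sq_eq_abs]
  refine Real.sqrt_le_sqrt ?_
  have hs1 : s ∈ Set.Icc (-1 : ℝ) 1 := ⟨by linarith [hs.1], hs.2⟩
  have hs2 : -s ∈ Set.Icc (-1 : ℝ) 1 := ⟨by linarith [hs.2], by linarith [hs.1]⟩
  set v := flow b s (c i) with hv
  set w := quad z v with hw
  have hcv : flow b (-s) v = c i := flow_neg_flow b _ s
  have h1 := inner_quad_flow b z v w s
  rw [hcv, ← hw, real_inner_self_eq_norm_sq] at h1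
  have hq : quad (flow b s z) (c i) = (l i * l i) • c i := by
    rw [hx.eq_sum, quad_csoi_apply hx.csoi]
  rw [hq, real_inner_smul_left] at h1
  have h2 : ‖w‖ ^ 2 ≤ (l i * l i) * (‖c i‖ * (K * ‖w‖)) := by
    rw [← h1]
    refine mul_le_mul_of_nonneg_left ?_ (mul_self_nonneg _)
    exact (real_inner_le_norm _ _).trans (by gcongr; exact hflow _ hs2 w)
  have hc0 : 0 < ‖c i‖ := norm_pos_iff.mpr (hx.ne_zero i)
  have h3 : ‖c i‖ ≤ K * (C * ‖w‖) := by
    rw [← hcv]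
    exact (hflow _ hs2 v).trans (by gcongr; exact hquad v)
  have hw0 : 0 < ‖w‖ := by
    by_contra h
    have : ‖w‖ = 0 := le_antisymm (not_lt.mp h) (norm_nonneg _)
    rw [this] at h3
    simp at h3
    exact hx.ne_zero i h3
  have h4 : ‖w‖ ≤ l i ^ 2 * (‖c i‖ * K) := by
    rw [pow_two] at h2
    refine le_of_mul_le_mul_right (h2.trans_eq ?_) hw0
    ring
  rw [div_le_iff₀ (by positivity)]
  have h5 : ‖c i‖ ≤ (l i ^ 2 * (K ^ 2 * C)) * ‖c i‖ := by
    calc ‖c i‖ ≤ K * (C * ‖w‖) := h3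
      _ ≤ K * (C * (l i ^ 2 * (‖c i‖ * K))) := by gcongr
      _ = _ := by ring
  exact (le_mul_iff_one_le_left hc0).mp h5

/-- Along the flow ⟨g(x), x'⟩ = 2⟨g(x), bx⟩ = 2⟨b, x g(x)⟩, which is 2k tr b if u g(u) = k on the
spectrum. The case k = 0 gives inertia, and k = 1 the logarithm. -/
theorem tr_apply_flow (b z : V) {K : Set ℝ} {T : ℝ} (hT : T ∈ Set.Icc (0 : ℝ) 1)
    (hK : ∀ s ∈ Set.Icc (0 : ℝ) T, ∀ (n : ℕ) (l : Fin n → ℝ) (c : Fin n → V),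
      IsSpectralDecomposition (flow b s z) l c → ∀ i, l i ∈ K)
    {f g : ℝ → ℝ} (hf : ∀ u, HasDerivAt f (g u) u) (hg : Continuous g) {k : ℝ}
    (hk : ∀ u ∈ K, u * g u = k) :
    tr (apply f (flow b T z)) = tr (apply f z) + 2 * k * tr b * T := by
  obtain ⟨A, hA, hflow⟩ := exists_norm_flow_le b
  obtain ⟨C, hC, hmul⟩ := exists_norm_mul_le (V := V)
  have hsub : ∀ s ∈ Set.Icc (0 : ℝ) T, s ∈ Set.Icc (-1 : ℝ) 1 := fun s hs =>
    ⟨by linarith [hs.1], hs.2.trans hT.2⟩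
  have h := tr_apply_sub_eq hT.1 (hasDerivAt_flow b z) (B := 2 * (C * ‖b‖ * (A * ‖z‖)))
    (M := C * (A * ‖z‖)) (k := 2 * k * tr b) ?_ (by positivity) ?_ hf hg ?_
  · rw [flow_zero] at h
    linarith
  · intro s hs
    rw [norm_smul, Real.norm_ofNat]
    gcongr
    refine (hmul _ _).trans ?_
    gcongr
    exact hflow s (hsub s hs) z
  · intro s hs v
    refine (hmul _ _).trans ?_
    gcongr
    exact hflow s (hsub s hs) z
  · intro s hs
    obtain ⟨n, l, c, hx⟩ := exists_isSpectralDecomposition (flow b s z)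
    have h1 : apply (fun u => u * g u) (flow b s z) = k • 1 := by
      rw [← apply_const (flow b s z) k]
      exact apply_congr hx fun i => hk _ (hK s hs n l c hx i)
    rw [real_inner_smul_right, ← inner_mul_left, mul_comm (apply g _) b,
      inner_mul_left, mul_comm (apply g _), mul_apply_eq, h1, real_inner_smul_right, tr_eq]
    ring

/-- The indicator function of the negative half line. -/
def negIndicator (u : ℝ) : ℝ := if u < 0 then 1 else 0

theorem exists_smooth_negIndicator {δ : ℝ} (hδ : 0 < δ) :
    ∃ f g : ℝ → ℝ, (∀ u, HasDerivAt f (g u) u) ∧ Continuous g ∧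
      ∀ u, δ ≤ |u| → f u = negIndicator u ∧ g u = 0 := by
  -- The transition takes place in [-δ/2, δ/2], strictly inside the gap, so the derivative vanishes
  -- also at |u| = δ.
  set f : ℝ → ℝ := fun u => Real.smoothTransition (1 / 2 - u / δ) with hf
  have hfs : ContDiff ℝ 1 f :=
    (Real.smoothTransition.contDiff (n := 1)).comp (contDiff_const.sub (contDiff_id.div_const δ))
  have hpos : ∀ u, δ / 2 < u → f u = 0 := fun u hu => by
    refine Real.smoothTransition.zero_of_nonpos ?_
    rw [sub_nonpos, le_div_iff₀ hδ]; linarith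
  have hneg : ∀ u, u < -(δ / 2) → f u = 1 := fun u hu => by
    refine Real.smoothTransition.one_of_one_le ?_
    rw [le_sub_comm, div_le_iff₀ hδ]; linarith
  refine ⟨f, deriv f, fun u => (hfs.differentiable one_ne_zero u).hasDerivAt,
    hfs.continuous_deriv le_rfl, fun u hu => ?_⟩
  rcases le_abs.mp hu with h | h
  · have h' : δ / 2 < u := by linarith
    refine ⟨by rw [hpos u h', negIndicator, if_neg (by linarith)], ?_⟩
    have : f =ᶠ[nhds u] fun _ => 0 :=
      Filter.eventuallyEq_of_mem (Ioi_mem_nhds h') fun v hv => hpos v hv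
    rw [this.deriv_eq, deriv_const]
  · have h' : u < -(δ / 2) := by linarith
    refine ⟨by rw [hneg u h', negIndicator, if_pos (by linarith)], ?_⟩
    have : f =ᶠ[nhds u] fun _ => 1 :=
      Filter.eventuallyEq_of_mem (Iio_mem_nhds h') fun v hv => hneg v hv
    rw [this.deriv_eq, deriv_const]

/-- The law of inertia: the flow preserves the trace of the negative spectral projection. -/
theorem tr_negIndicator_flow (b : V) {z : V} (hz : Function.Injective (quad z)) {T : ℝ}
    (hT : T ∈ Set.Icc (0 : ℝ) 1) :
    tr (apply negIndicator (flow b T z)) = tr (apply negIndicator z) := by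
  obtain ⟨δ, hδ, hgap⟩ := exists_eigenvalue_gap b hz
  obtain ⟨f, g, hf, hg, hfg⟩ := exists_smooth_negIndicator hδ
  have h := tr_apply_flow b z (K := {u | δ ≤ |u|}) hT
    (fun s hs => hgap s ⟨hs.1, hs.2.trans hT.2⟩) hf hg (k := 0)
    fun u hu => by rw [(hfg u hu).2, mul_zero]
  have key : ∀ s ∈ Set.Icc (0 : ℝ) 1,
      apply f (flow b s z) = apply negIndicator (flow b s z) := fun s hs => by
    obtain ⟨n, l, c, hx⟩ := exists_isSpectralDecomposition (flow b s z)
    exact apply_congr hx fun i => (hfg _ (hgap s hs n l c hx i)).1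
  have h0 := key 0 ⟨le_rfl, zero_le_one⟩
  rw [flow_zero] at h0
  rw [key T hT, h0] at h
  simpa using h

theorem eigenvalue_nonneg_iff {x : V} {n : ℕ} {l : Fin n → ℝ} {c : Fin n → V}
    (hx : IsSpectralDecomposition x l c) :
    tr (apply negIndicator x) = 0 ↔ ∀ i, 0 ≤ l i := by
  rw [hx.eq_sum, hx.csoi.tr_apply, Finset.sum_eq_zero_iff_of_nonneg]
  · refine ⟨fun h i => ?_, fun h i _ => by simp [negIndicator, not_lt.mpr (h i)]⟩
    by_contra hi
    have := h i (Finset.mem_univ i)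
    rw [negIndicator, if_pos (not_le.mp hi), one_mul] at this
    exact (hx.tr_pos i).ne' this
  · intro i _
    have := (hx.tr_pos i).le
    rw [negIndicator]
    split_ifs <;> simp [this]

/-- The flow multiplies the determinant of a positive element. -/
theorem tr_log_flow (b : V) {z : V} (hz : Function.Injective (quad z))
    (hpos : tr (apply negIndicator z) = 0) :
    tr (log (flow b 1 z)) = tr (log z) + 2 * tr b := by
  obtain ⟨δ, hδ, hgap⟩ := exists_eigenvalue_gap b hz
  have hgap' : ∀ s ∈ Set.Icc (0 : ℝ) 1, ∀ (n : ℕ) (l : Fin n → ℝ) (c : Fin n → V),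
      IsSpectralDecomposition (flow b s z) l c → ∀ i, δ ≤ l i := fun s hs n l c hx i => by
    have h1 := tr_negIndicator_flow b hz hs
    rw [hpos, eigenvalue_nonneg_iff hx] at h1
    have := hgap s hs n l c hx i
    rwa [abs_of_nonneg (h1 i)] at this
  -- A continuous extension of 1/u from [δ, ∞); its primitive f agrees there with the logarithm.
  set g : ℝ → ℝ := fun u => (max u δ)⁻¹ with hg
  have hgc : Continuous g :=
    (continuous_id.max continuous_const).inv₀ fun u => (hδ.trans_le (le_max_right _ _)).ne'
  set f : ℝ → ℝ := fun u => Real.log δ + ∫ v in δ..u, g v with hf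
  have hfd : ∀ u, HasDerivAt f (g u) u := fun u =>
    (hgc.integral_hasStrictDerivAt δ u).hasDerivAt.const_add _
  have hfl : ∀ u, δ ≤ u → f u = Real.log u := fun u hu => by
    have : ∫ v in δ..u, g v = ∫ v in δ..u, v⁻¹ := by
      refine intervalIntegral.integral_congr fun v hv => ?_
      rw [Set.uIcc_of_le hu] at hv
      simp only [hg, max_eq_left hv.1]
    rw [hf]
    simp only
    rw [this, integral_inv_of_pos hδ (hδ.trans_le hu),
      Real.log_div (hδ.trans_le hu).ne' hδ.ne']
    ring
  have h := tr_apply_flow b z (K := {u | δ ≤ u}) (T := 1) ⟨zero_le_one, le_rfl⟩ hgap' hfd hgc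
    (k := 1) fun u hu => by
      have hu0 : δ ≤ u := hu
      simp only [hg, max_eq_left hu0]
      exact mul_inv_cancel₀ (hδ.trans_le hu0).ne'
  have key : ∀ s ∈ Set.Icc (0 : ℝ) 1, apply f (flow b s z) = log (flow b s z) := fun s hs => by
    obtain ⟨n, l, c, hx⟩ := exists_isSpectralDecomposition (flow b s z)
    exact apply_congr hx fun i => hfl _ (hgap' s hs n l c hx i)
  have h0 := key 0 ⟨le_rfl, zero_le_one⟩
  rw [flow_zero] at h0
  rw [key 1 ⟨zero_le_one, le_rfl⟩, h0] at h
  simpa using h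

end Flow

/-! ### Scalar integrals for the weight and the negative half line. -/

section ScalarIntegrals

open MeasureTheory Set Filter Topology

theorem lintegral_Ioi_of_hasDerivAt {g g' : ℝ → ℝ} {a l : ℝ}
    (hcont : ContinuousWithinAt g (Ici a) a) (hderiv : ∀ x ∈ Ioi a, HasDerivAt g (g' x) x)
    (hpos : ∀ x ∈ Ioi a, 0 ≤ g' x) (hg : Tendsto g atTop (𝓝 l)) :
    ∫⁻ x in Ioi a, ENNReal.ofReal (g' x) = ENNReal.ofReal (l - g a) := by
  rw [← integral_Ioi_of_hasDerivAt_of_nonneg hcont hderiv hpos hg]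
  refine (ofReal_integral_eq_lintegral_ofReal
    (integrableOn_Ioi_deriv_of_nonneg hcont hderiv hpos hg) ?_).symm
  exact (ae_restrict_iff' measurableSet_Ioi).mpr (ae_of_all _ hpos)

/-- The weight in the integral formula for the relative entropy. -/
def weight (u : ℝ) : ℝ := (u ^ 2 * |u - 1|)⁻¹

theorem weight_nonneg (u : ℝ) : 0 ≤ weight u := by unfold weight; positivity

theorem measurable_weight : Measurable weight := by unfold weight; fun_prop

theorem measurable_negIndicator : Measurable negIndicator :=
  Measurable.ite measurableSet_Iio measurable_const measurable_const

theorem negIndicator_nonneg (u : ℝ) : 0 ≤ negIndicator u := by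
  unfold negIndicator; split_ifs <;> norm_num

theorem hasDerivAt_log_one_sub_inv {u : ℝ} (hu : u ≠ 0) (hu1 : u ≠ 1) :
    HasDerivAt (fun u => Real.log (1 - u⁻¹) + u⁻¹) (u ^ 2 * (u - 1))⁻¹ u := by
  have h1 : 1 - u⁻¹ ≠ 0 := fun h => hu1 (inv_eq_one.mp (sub_eq_zero.mp h).symm)
  have h2 := hasDerivAt_inv hu
  refine (((h2.const_sub 1).log h1).add h2).congr_deriv ?_
  have h3 : u - 1 ≠ 0 := sub_ne_zero.mpr hu1
  have h4 : 1 - u⁻¹ = (u - 1) / u := by field_simp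
  rw [h4]
  field_simp
  ring

theorem tendsto_log_one_sub_inv :
    Tendsto (fun u : ℝ => Real.log (1 - u⁻¹) + u⁻¹) atTop (𝓝 0) := by
  have h : Tendsto (fun u : ℝ => u⁻¹) atTop (𝓝 0) := tendsto_inv_atTop_zero
  have h1 : Tendsto (fun u : ℝ => Real.log (1 - u⁻¹)) atTop (𝓝 (Real.log (1 - 0))) :=
    (h.const_sub 1).log (by norm_num)
  simpa using h1.add h

theorem tendsto_log_one_add_inv :
    Tendsto (fun u : ℝ => Real.log (1 + u⁻¹) - u⁻¹) atTop (𝓝 0) := by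
  have h : Tendsto (fun u : ℝ => u⁻¹) atTop (𝓝 0) := tendsto_inv_atTop_zero
  have h1 : Tendsto (fun u : ℝ => Real.log (1 + u⁻¹)) atTop (𝓝 (Real.log (1 + 0))) :=
    (h.const_add 1).log (by norm_num)
  simpa using h1.sub h

/-- The integrand lives on a half line ending at u = -1/ξ. For ξ < 0 the hypothesis puts this end
beyond the singularity u = 1; for ξ > 0 the half line is negative and is reflected. The primitives
vanish at infinity. -/
theorem lintegral_weight {ξ : ℝ} (hξ : 0 < 1 + ξ) :
    ∫⁻ u, ENNReal.ofReal (weight u * negIndicator (1 + u * ξ)) =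
      ENNReal.ofReal (ξ - Real.log (1 + ξ)) := by
  rcases lt_trichotomy ξ 0 with h | rfl | h
  · have ha : 1 < (-ξ)⁻¹ := (one_lt_inv₀ (by linarith)).mpr (by linarith)
    have hset : ∀ u, u ∈ Ioi (-ξ)⁻¹ ↔ 1 + u * ξ < 0 := fun u => by
      rw [mem_Ioi, inv_lt_iff_one_lt_mul₀ (by linarith)]
      constructor <;> intro h <;> linarith
    have h1 : ∀ u, ENNReal.ofReal (weight u * negIndicator (1 + u * ξ)) =
        (Ioi (-ξ)⁻¹).indicator (fun u => ENNReal.ofReal (u ^ 2 * (u - 1))⁻¹) u := fun u => by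
      by_cases hu : u ∈ Ioi (-ξ)⁻¹
      · have hu1 : 1 < u := ha.trans hu
        rw [indicator_of_mem hu, negIndicator, if_pos ((hset u).mp hu), mul_one, weight,
          abs_of_pos (by linarith)]
      · rw [indicator_of_notMem hu, negIndicator, if_neg (fun h => hu ((hset u).mpr h)), mul_zero,
          ENNReal.ofReal_zero]
    simp_rw [h1]
    rw [lintegral_indicator measurableSet_Ioi, lintegral_Ioi_of_hasDerivAt
      (g := fun u => Real.log (1 - u⁻¹) + u⁻¹) _ _ _ tendsto_log_one_sub_inv]
    · congr 1
      rw [inv_inv]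
      ring_nf
    · exact (hasDerivAt_log_one_sub_inv (by linarith) ha.ne').continuousAt.continuousWithinAt
    · intro u hu
      have hu1 : 1 < u := ha.trans hu
      exact hasDerivAt_log_one_sub_inv (by linarith) hu1.ne'
    · intro u hu
      have hu1 : 1 < u := ha.trans hu
      have : 0 < u - 1 := by linarith
      positivity
  · simp [negIndicator, show ¬ (1 : ℝ) < 0 by norm_num]
  · have ha : 0 < ξ⁻¹ := by positivity
    have hset : ∀ u, u ∈ Ioi ξ⁻¹ ↔ 1 + -u * ξ < 0 := fun u => by
      rw [mem_Ioi, inv_lt_iff_one_lt_mul₀ h]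
      constructor <;> intro h <;> linarith
    rw [← lintegral_neg_eq_self]
    have h1 : ∀ u, ENNReal.ofReal (weight (-u) * negIndicator (1 + -u * ξ)) =
        (Ioi ξ⁻¹).indicator (fun u => ENNReal.ofReal (u ^ 2 * (u + 1))⁻¹) u := fun u => by
      by_cases hu : u ∈ Ioi ξ⁻¹
      · have hu1 : 0 < u := ha.trans hu
        rw [indicator_of_mem hu, negIndicator, if_pos ((hset u).mp hu), mul_one, weight,
          abs_of_neg (by linarith)]
        congr 2
        ring
      · rw [indicator_of_notMem hu, negIndicator, if_neg (fun h => hu ((hset u).mpr h)), mul_zero,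
          ENNReal.ofReal_zero]
    have hd : ∀ u, 0 < u →
        HasDerivAt (fun u : ℝ => Real.log (1 + u⁻¹) - u⁻¹) (u ^ 2 * (u + 1))⁻¹ u := fun u hu => by
      have h2 := hasDerivAt_inv hu.ne'
      have h3 : 0 < 1 + u⁻¹ := by positivity
      refine (((h2.const_add 1).log h3.ne').sub h2).congr_deriv ?_
      have h4 : 1 + u⁻¹ = (u + 1) / u := by field_simp
      rw [h4]
      field_simp
      ring
    simp_rw [h1]
    rw [lintegral_indicator measurableSet_Ioi, lintegral_Ioi_of_hasDerivAt
      (g := fun u => Real.log (1 + u⁻¹) - u⁻¹) _ _ _ tendsto_log_one_add_inv]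
    · congr 1
      rw [inv_inv]
      ring
    · exact (hd _ ha).continuousAt.continuousWithinAt
    · exact fun u hu => hd u (ha.trans hu)
    · intro u hu
      have hu1 : 0 < u := ha.trans hu
      positivity

theorem lintegral_negIndicator (a : ℝ) :
    ∫⁻ r in Ioi (0 : ℝ), ENNReal.ofReal (negIndicator (a + r)) = ENNReal.ofReal (max (-a) 0) := by
  have h1 : ∀ r, ENNReal.ofReal (negIndicator (a + r)) = (Iio (-a)).indicator 1 r := fun r => by
    by_cases hr : r ∈ Iio (-a)
    · rw [indicator_of_mem hr, negIndicator, if_pos (by rw [mem_Iio] at hr; linarith)]; simp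
    · rw [indicator_of_notMem hr, negIndicator, if_neg (by rw [mem_Iio] at hr; linarith)]; simp
  simp_rw [h1]
  rw [lintegral_indicator_one measurableSet_Iio, Measure.restrict_apply measurableSet_Iio,
    Iio_inter_Ioi, Real.volume_Ioo, sub_zero, ENNReal.ofReal_max, ENNReal.ofReal_zero]
  exact (max_eq_left zero_le).symm

end ScalarIntegrals

/-! ### Diagonalization of pencils and the integral over u. -/

section Pencil

open MeasureTheory

variable {V : Type*} [NonAssocCommRing V] [Module ℝ V] [EuclideanJordanAlgebra V]

theorem quad_flow_injective (b z : V) (h : Function.Injective (quad (flow b 1 z))) :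
    Function.Injective (quad z) := by
  rw [injective_iff_map_eq_zero] at h ⊢
  intro v hv
  have h1 : quad (flow b 1 z) (flow b (-1) v) = 0 := by
    refine ext_inner_right ℝ fun w => ?_
    have := inner_quad_flow b z v (flow b 1 w) 1
    rwa [flow_neg_flow, hv, inner_zero_left, ← inner_zero_left (𝕜 := ℝ) w] at this
  rw [← flow_flow_neg b v 1, h _ h1, map_zero]

omit [EuclideanJordanAlgebra V] in
theorem IsCSOI.one_add_smul {n : ℕ} {c : Fin n → V} (hc : IsCSOI c)
    (ξ : Fin n → ℝ) (a u : ℝ) :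
    a • (1 : V) + u • ∑ k, ξ k • c k = ∑ k, (a + u * ξ k) • c k := by
  rw [← hc.complete, Finset.smul_sum, Finset.smul_sum, ← Finset.sum_add_distrib]
  simp only [add_smul, mul_smul]

/-- Simultaneous diagonalization of a pencil `y + u E` with `y` and `y + E` positive definite. -/
theorem exists_pencil {n : ℕ} {m : Fin n → ℝ} {d : Fin n → V} (hd : IsCSOI d)
    (hm : ∀ i, 0 < m i) {y E : V} (hy : y = ∑ i, m i • d i)
    (hquad : Function.Injective (quad (y + E))) (hpos : tr (apply negIndicator (y + E)) = 0) :
    ∃ (N : ℕ) (ξ : Fin N → ℝ) (w : Fin N → ℝ), (∀ k, 0 < 1 + ξ k) ∧ (∀ k, 0 ≤ w k) ∧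
      inner ℝ E (apply (fun u => u⁻¹) y) = ∑ k, w k * ξ k ∧
      tr (log (y + E)) = tr (log y) + ∑ k, w k * Real.log (1 + ξ k) ∧
      ∀ u, (∀ k, 1 + u * ξ k ≠ 0) →
        tr (apply negIndicator (y + u • E)) = ∑ k, w k * negIndicator (1 + u * ξ k) := by
  -- Half the logarithm of y, so that exp(2L(b)) takes 1 to y and its inverse takes 1 to y⁻¹.
  set b := ∑ i, (Real.log (m i) / 2) • d i with hb
  have hb1 : flow b 1 1 = y := by
    rw [hb, flow_one hd, hy]
    refine Finset.sum_congr rfl fun i _ => ?_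
    rw [mul_one, mul_div_cancel₀ _ (two_ne_zero), Real.exp_log (hm i)]
  have hb2 : flow b (-1) 1 = apply (fun u => u⁻¹) y := by
    rw [hb, flow_one hd, hy, hd.apply_eq]
    refine Finset.sum_congr rfl fun i _ => ?_
    rw [mul_neg_one, neg_mul, mul_div_cancel₀ _ (two_ne_zero), Real.exp_neg, Real.exp_log (hm i)]
  have hb3 : 2 * tr b = tr (log y) := by
    rw [hb, hy, log, hd.apply_eq, tr_sum, tr_sum, Finset.mul_sum]
    refine Finset.sum_congr rfl fun i _ => ?_
    rw [tr_smul, tr_smul]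
    ring
  obtain ⟨N, ξ, c, hX⟩ := exists_isSpectralDecomposition (flow b (-1) E)
  have hflow : ∀ u : ℝ, flow b 1 (∑ k, (1 + u * ξ k) • c k) = y + u • E := fun u => by
    rw [← hX.csoi.one_add_smul, ← hX.eq_sum, one_smul, map_add, hb1, map_smul, flow_flow_neg]
  have hflow1 : flow b 1 (∑ k, (1 + ξ k) • c k) = y + E := by simpa using hflow 1
  have hz : IsSpectralDecomposition (∑ k, (1 + ξ k) • c k) (fun k => 1 + ξ k) c :=
    ⟨hX.csoi, hX.ne_zero, fun i j h => hX.distinct (add_left_cancel h), rfl⟩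
  have hzinj : Function.Injective (quad (∑ k, (1 + ξ k) • c k)) :=
    quad_flow_injective b _ (by rwa [hflow1])
  have hmem : (1 : ℝ) ∈ Set.Icc (0 : ℝ) 1 := ⟨zero_le_one, le_rfl⟩
  have hzpos : tr (apply negIndicator (∑ k, (1 + ξ k) • c k)) = 0 := by
    rw [← tr_negIndicator_flow b hzinj hmem, hflow1, hpos]
  have hnn := (eigenvalue_nonneg_iff hz).mp hzpos
  refine ⟨N, ξ, fun k => tr (c k), fun k => (hnn k).lt_of_ne fun h => hX.ne_zero k ?_,
    fun k => tr_idempotent_nonneg (hX.csoi.idempotent k), ?_, ?_, fun u hu => ?_⟩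
  -- If 1 + ξₖ were 0, then cₖ would lie in the kernel of the injective P(z).
  · refine hzinj ?_
    rw [quad_csoi_apply hX.csoi, map_zero, ← h, mul_zero, zero_smul]
  · rw [← hb2, ← inner_flow_neg, ← tr_eq, hX.eq_sum, tr_sum]
    exact Finset.sum_congr rfl fun k _ => by rw [tr_smul, mul_comm]
  · rw [← hflow1, tr_log_flow b hzinj hzpos, hb3, log, hX.csoi.tr_apply, add_comm]
    simp only [mul_comm]
  · rw [← hflow u, tr_negIndicator_flow b (quad_injective hX.csoi hu) hmem, hX.csoi.tr_apply]
    simp only [mul_comm]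

/-- The integral formula for the Bregman divergence of the logarithm of the determinant. -/
theorem lintegral_pencil {n : ℕ} {m : Fin n → ℝ} {d : Fin n → V} (hd : IsCSOI d)
    (hm : ∀ i, 0 < m i) {y E : V} (hy : y = ∑ i, m i • d i)
    (hquad : Function.Injective (quad (y + E))) (hpos : tr (apply negIndicator (y + E)) = 0) :
    0 ≤ inner ℝ E (apply (fun u => u⁻¹) y) - tr (log (y + E)) + tr (log y) ∧
    ∫⁻ u, ENNReal.ofReal (weight u) * ENNReal.ofReal (tr (apply negIndicator (y + u • E))) =
      ENNReal.ofReal (inner ℝ E (apply (fun u => u⁻¹) y) - tr (log (y + E)) + tr (log y)) := by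
  obtain ⟨N, ξ, w, hξ, hw, h1, h2, h3⟩ := exists_pencil hd hm hy hquad hpos
  have hG : inner ℝ E (apply (fun u => u⁻¹) y) - tr (log (y + E)) + tr (log y) =
      ∑ k, w k * (ξ k - Real.log (1 + ξ k)) := by
    rw [h1, h2]
    simp only [mul_sub, Finset.sum_sub_distrib]
    ring
  have hterm : ∀ k, 0 ≤ ξ k - Real.log (1 + ξ k) := fun k => by
    have := Real.log_le_sub_one_of_pos (hξ k)
    linarith
  rw [hG]
  refine ⟨Finset.sum_nonneg fun k _ => mul_nonneg (hw k) (hterm k), ?_⟩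
  -- Inertia needs an invertible element; the pencil is singular for only finitely many u.
  have hae : ∀ᵐ u : ℝ, ∀ k, 1 + u * ξ k ≠ 0 := by
    rw [ae_all_iff]
    intro k
    have : {u : ℝ | 1 + u * ξ k = 0} ⊆ {-(ξ k)⁻¹} := fun u hu => by
      have hu' : 1 + u * ξ k = 0 := hu
      have hne : ξ k ≠ 0 := fun h => by simp [h] at hu'
      rw [Set.mem_singleton_iff]
      field_simp
      linarith
    rw [ae_iff]
    simpa using measure_mono_null this (measure_singleton _)
  have hint : ∀ᵐ u : ℝ, ENNReal.ofReal (weight u) *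
      ENNReal.ofReal (tr (apply negIndicator (y + u • E))) =
      ∑ k, ENNReal.ofReal (w k) * ENNReal.ofReal (weight u * negIndicator (1 + u * ξ k)) := by
    filter_upwards [hae] with u hu
    rw [h3 u hu, ← ENNReal.ofReal_mul (weight_nonneg u), Finset.mul_sum,
      ENNReal.ofReal_sum_of_nonneg]
    · refine Finset.sum_congr rfl fun k _ => ?_
      rw [← ENNReal.ofReal_mul (hw k)]
      congr 1
      ring
    · exact fun k _ => mul_nonneg (weight_nonneg u) (mul_nonneg (hw k) (negIndicator_nonneg _))
  have hmeas : ∀ k, Measurable fun u =>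
      ENNReal.ofReal (weight u * negIndicator (1 + u * ξ k)) := fun k =>
    (measurable_weight.mul (measurable_negIndicator.comp (by fun_prop))).ennreal_ofReal
  rw [lintegral_congr_ae hint, lintegral_finsetSum _ fun k _ => (hmeas k).const_mul _,
    ENNReal.ofReal_sum_of_nonneg fun k _ => mul_nonneg (hw k) (hterm k)]
  refine Finset.sum_congr rfl fun k _ => ?_
  rw [lintegral_const_mul _ (hmeas k), lintegral_weight (hξ k), ENNReal.ofReal_mul (hw k)]

end Pencil

/-! ### The integral over r, by an explicit primitive. -/

section ScalarEntropy

open MeasureTheory Set Filter Topology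

theorem tendsto_mul_log_one_add_div (a μ : ℝ) :
    Tendsto (fun r : ℝ => (a + r) * Real.log (1 + μ / r)) atTop (𝓝 μ) := by
  have h1 := Real.tendsto_mul_log_one_add_div_atTop μ
  have h2 : Tendsto (fun r : ℝ => Real.log (1 + μ / r)) atTop (𝓝 (Real.log (1 + 0))) :=
    (((tendsto_const_nhds (x := μ)).div_atTop tendsto_id).const_add 1).log (by norm_num)
  have h3 := (h2.const_mul a).add h1
  simpa [add_mul] using h3

variable {ι κ : Type*} [Fintype ι] [Fintype κ]

/-- The regularized relative entropy of spectral data. -/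
def entropyPotential (l w : ι → ℝ) (μ v e : κ → ℝ) (r : ℝ) : ℝ :=
  ∑ j, (e j - v j * μ j) * Real.log (μ j + r) + ∑ j, v j * ((μ j + r) * Real.log (μ j + r)) -
    ∑ i, w i * ((l i + r) * Real.log (l i + r))

theorem hasDerivAt_entropyPotential {l w : ι → ℝ} {μ v e : κ → ℝ} (hl : ∀ i, 0 ≤ l i)
    (hμ : ∀ j, 0 ≤ μ j) (hwv : ∑ i, w i = ∑ j, v j) {r : ℝ} (hr : 0 < r) :
    HasDerivAt (entropyPotential l w μ v e)
      (∑ j, (e j - v j * μ j) * (μ j + r)⁻¹ - ∑ i, w i * Real.log (l i + r) +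
        ∑ j, v j * Real.log (μ j + r)) r := by
  have hadd : ∀ a : ℝ, HasDerivAt (fun r => a + r) 1 r := fun a => (hasDerivAt_id r).const_add a
  have hη : ∀ a : ℝ, 0 ≤ a →
      HasDerivAt (fun r => (a + r) * Real.log (a + r)) (Real.log (a + r) + 1) r := fun a ha => by
    have h := (Real.hasDerivAt_mul_log (by positivity : a + r ≠ 0)).comp r (hadd a)
    rw [mul_one] at h
    exact h
  have h1 : HasDerivAt (fun r => ∑ j, (e j - v j * μ j) * Real.log (μ j + r))
      (∑ j, (e j - v j * μ j) * (μ j + r)⁻¹) r := HasDerivAt.fun_sum fun j _ => by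
    have hpos := hμ j
    have h := ((hadd (μ j)).log (by positivity)).const_mul (e j - v j * μ j)
    rwa [one_div] at h
  have h2 : HasDerivAt (fun r => ∑ j, v j * ((μ j + r) * Real.log (μ j + r)))
      (∑ j, v j * (Real.log (μ j + r) + 1)) r :=
    HasDerivAt.fun_sum fun j _ => (hη _ (hμ j)).const_mul _
  have h3 : HasDerivAt (fun r => ∑ i, w i * ((l i + r) * Real.log (l i + r)))
      (∑ i, w i * (Real.log (l i + r) + 1)) r :=
    HasDerivAt.fun_sum fun i _ => (hη _ (hl i)).const_mul _
  refine ((h1.add h2).sub h3).congr_deriv ?_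
  simp only [mul_add, mul_one, Finset.sum_add_distrib, hwv]
  ring

/-- Where μⱼ = 0 the logarithm blows up as r → 0, but the support condition `he` makes its
coefficient zero. -/
theorem continuous_entropyPotential_zero (l w : ι → ℝ) {μ v e : κ → ℝ}
    (he : ∀ j, μ j = 0 → e j = 0) : ContinuousAt (entropyPotential l w μ v e) 0 := by
  have hη : ∀ a : ℝ, Continuous fun r => (a + r) * Real.log (a + r) := fun a =>
    Real.continuous_mul_log.comp (by fun_prop : Continuous fun r : ℝ => a + r)
  refine ContinuousAt.sub (ContinuousAt.add ?_ ?_) ?_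
  · refine tendsto_finsetSum _ fun j _ => ?_
    by_cases h : μ j = 0
    · simp [h, he j h]
    · have : ContinuousAt (fun r => Real.log (μ j + r)) 0 :=
        (by fun_prop : ContinuousAt (fun r : ℝ => μ j + r) 0).log (by simpa using h)
      exact continuousAt_const.mul this
  · exact (continuous_finsetSum _ fun j _ => continuous_const.mul (hη _)).continuousAt
  · exact (continuous_finsetSum _ fun j _ => continuous_const.mul (hη _)).continuousAt

/-- Splitting log(a + r) = log r + log(1 + a/r), the log r terms cancel by the trace identities, and
(a + r) log(1 + μ/r) → μ handles the rest. -/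
theorem tendsto_entropyPotential {l w : ι → ℝ} {μ v e : κ → ℝ} (hl : ∀ i, 0 ≤ l i)
    (hμ : ∀ j, 0 ≤ μ j) (hwv : ∑ i, w i = ∑ j, v j) (hwe : ∑ i, w i * l i = ∑ j, e j)
    (hve : ∑ j, v j * μ j = ∑ j, e j) :
    Tendsto (entropyPotential l w μ v e) atTop (𝓝 0) := by
  have hlog : ∀ a : ℝ, 0 ≤ a → ∀ r : ℝ, 0 < r →
      Real.log (a + r) = Real.log r + Real.log (1 + a / r) := fun a ha r hr => by
    rw [← Real.log_mul hr.ne' (by positivity)]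
    congr 1
    field_simp
    ring
  have h2 : ∀ a : ℝ, Tendsto (fun r : ℝ => Real.log (1 + a / r)) atTop (𝓝 0) := fun a => by
    have : Tendsto (fun r : ℝ => Real.log (1 + a / r)) atTop (𝓝 (Real.log (1 + 0))) :=
      (((tendsto_const_nhds (x := a)).div_atTop tendsto_id).const_add 1).log (by norm_num)
    simpa using this
  have hlim : Tendsto (fun r : ℝ => ∑ j, (e j - v j * μ j) * Real.log (1 + μ j / r) +
      ∑ j, v j * ((μ j + r) * Real.log (1 + μ j / r)) -
      ∑ i, w i * ((l i + r) * Real.log (1 + l i / r))) atTop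
      (𝓝 (∑ j, (e j - v j * μ j) * 0 + ∑ j, v j * μ j - ∑ i, w i * l i)) :=
    ((tendsto_finsetSum _ fun j _ => (h2 _).const_mul _).add
      (tendsto_finsetSum _ fun j _ => (tendsto_mul_log_one_add_div _ _).const_mul _)).sub
      (tendsto_finsetSum _ fun i _ => (tendsto_mul_log_one_add_div _ _).const_mul _)
  simp only [mul_zero, Finset.sum_const_zero, zero_add, hve, hwe, sub_self] at hlim
  refine hlim.congr' ?_
  filter_upwards [eventually_gt_atTop 0] with r hr
  have hcoef : ∑ j, (e j - v j * μ j) * Real.log r + ∑ j, v j * ((μ j + r) * Real.log r) -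
      ∑ i, w i * ((l i + r) * Real.log r) = 0 := by
    have h1 : ∑ j, (e j - v j * μ j) * Real.log r = 0 := by
      rw [← Finset.sum_mul, Finset.sum_sub_distrib, hve, sub_self, zero_mul]
    have h3 : ∑ j, v j * ((μ j + r) * Real.log r) =
        (∑ j, v j * μ j + r * ∑ j, v j) * Real.log r := by
      rw [Finset.mul_sum, ← Finset.sum_add_distrib, Finset.sum_mul]
      exact Finset.sum_congr rfl fun j _ => by ring
    have h4 : ∑ i, w i * ((l i + r) * Real.log r) =
        (∑ i, w i * l i + r * ∑ i, w i) * Real.log r := by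
      rw [Finset.mul_sum, ← Finset.sum_add_distrib, Finset.sum_mul]
      exact Finset.sum_congr rfl fun j _ => by ring
    rw [h1, h3, h4, hwv, hwe, hve]
    ring
  unfold entropyPotential
  simp only [hlog _ (hl _) r hr, hlog _ (hμ _) r hr, mul_add, Finset.sum_add_distrib] at hcoef ⊢
  linarith

/-- G is the derivative of `entropyPotential`, which tends to 0 at infinity and equals minus the
relative entropy at 0. -/
theorem lintegral_entropy {l w : ι → ℝ} {μ v e : κ → ℝ} (hl : ∀ i, 0 ≤ l i)
    (hμ : ∀ j, 0 ≤ μ j) (hwv : ∑ i, w i = ∑ j, v j) (hwe : ∑ i, w i * l i = ∑ j, e j)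
    (hve : ∑ j, v j * μ j = ∑ j, e j) (he : ∀ j, μ j = 0 → e j = 0) {G : ℝ → ℝ}
    (hG : ∀ r > 0, G r = ∑ j, (e j - v j * μ j) * (μ j + r)⁻¹ -
      ∑ i, w i * Real.log (l i + r) + ∑ j, v j * Real.log (μ j + r))
    (hG0 : ∀ r > 0, 0 ≤ G r) :
    0 ≤ ∑ i, w i * (l i * Real.log (l i)) - ∑ j, e j * Real.log (μ j) ∧
    ∫⁻ r in Ioi (0 : ℝ), ENNReal.ofReal (G r) =
      ENNReal.ofReal (∑ i, w i * (l i * Real.log (l i)) - ∑ j, e j * Real.log (μ j)) := by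
  have hderiv : ∀ r ∈ Ioi (0 : ℝ), HasDerivAt (entropyPotential l w μ v e) (G r) r :=
    fun r hr => hG r hr ▸ hasDerivAt_entropyPotential hl hμ hwv hr
  have hcont := continuous_entropyPotential_zero l w (v := v) he
  have hlim := tendsto_entropyPotential hl hμ hwv hwe hve
  have h0 : ∑ i, w i * (l i * Real.log (l i)) - ∑ j, e j * Real.log (μ j) =
      0 - entropyPotential l w μ v e 0 := by
    simp only [entropyPotential, add_zero, sub_mul, Finset.sum_sub_distrib, mul_assoc]
    ring
  rw [h0]
  refine ⟨?_, lintegral_Ioi_of_hasDerivAt hcont.continuousWithinAt hderiv hG0 hlim⟩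
  have hmono : MonotoneOn (entropyPotential l w μ v e) (Ici 0) := by
    refine monotoneOn_of_deriv_nonneg (convex_Ici 0) (fun r hr => ?_) (fun r hr => ?_)
      fun r hr => ?_
    · rcases (mem_Ici.mp hr).eq_or_lt with rfl | h
      · exact hcont.continuousWithinAt
      · exact (hderiv r h).continuousAt.continuousWithinAt
    · rw [interior_Ici] at hr
      exact (hderiv r hr).differentiableAt.differentiableWithinAt
    · rw [interior_Ici] at hr
      rw [(hderiv r hr).deriv]
      exact hG0 r hr
  rw [sub_nonneg]
  refine ge_of_tendsto hlim ?_
  filter_upwards [eventually_ge_atTop 0] with r hr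
  exact hmono self_mem_Ici hr hr

end ScalarEntropy

/-! ### Measurability of traces of spectral functions. -/

section Measurability

open MeasureTheory Filter Topology Polynomial

variable {V : Type*} [NonAssocCommRing V] [Module ℝ V] [EuclideanJordanAlgebra V]

theorem continuous_bilinear {E : Type*} [NormedAddCommGroup E] [NormedSpace ℝ E]
    [FiniteDimensional ℝ E] (B : E →ₗ[ℝ] E →ₗ[ℝ] E) {X : Type*} [TopologicalSpace X] {f g : X → E}
    (hf : Continuous f) (hg : Continuous g) : Continuous fun x => B (f x) (g x) :=
  (B.toContinuousBilinearMap.continuous.comp hf).clm_apply hg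

theorem continuous_tr_evalPoly (p : ℝ[X]) : Continuous fun x : V => tr (evalPoly x p) := by
  have h : Continuous fun x : V => evalPoly x p := by
    induction p using Polynomial.induction_on' with
    | add p q hp hq => simp only [map_add]; exact hp.add hq
    | monomial n a =>
      simp only [← C_mul_X_pow_eq_monomial, ← smul_eq_C_mul, map_smul]
      refine Continuous.const_smul ?_ a
      induction n with
      | zero => simpa using continuous_const
      | succ n ih =>
        simp only [pow_succ', evalPoly_X_mul]
        exact continuous_bilinear (LinearMap.mul ℝ V) continuous_id ih
  exact h.inner continuous_const

/-- By Weierstrass the function is a locally uniform limit of the continuous functions tr p(x): the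
spectrum of x is bounded by a multiple of ‖x‖. -/
theorem continuous_tr_apply {h : ℝ → ℝ} (hh : Continuous h) :
    Continuous fun x : V => tr (apply h x) := by
  obtain ⟨C, hC, hmul⟩ := exists_norm_mul_le (V := V)
  refine continuous_iff_continuousAt.mpr fun x₀ => ?_
  refine continuousAt_of_locally_uniform_approx_of_continuousAt fun U hU => ?_
  obtain ⟨ε, hε, hεU⟩ := Metric.mem_uniformity_dist.mp hU
  have htr := tr_one_nonneg (V := V)
  set η := ε / (2 * (tr (1 : V) + 1)) with hη
  have hη0 : 0 < η := by positivity
  set M := C * (‖x₀‖ + 1)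
  obtain ⟨q, hq⟩ := exists_polynomial_near_of_continuousOn (-M) M h hh.continuousOn η hη0
  refine ⟨Metric.ball x₀ 1, Metric.ball_mem_nhds x₀ one_pos, fun x => tr (evalPoly x q),
    (continuous_tr_evalPoly q).continuousAt, fun y hy => hεU ?_⟩
  have hy' : ‖y‖ ≤ ‖x₀‖ + 1 := by
    have h1 := norm_sub_norm_le y x₀
    have h2 : ‖y - x₀‖ < 1 := mem_ball_iff_norm.mp hy
    linarith
  have hM : ∀ v, ‖y * v‖ ≤ M * ‖v‖ := fun v => (hmul y v).trans (by simp only [M]; gcongr)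
  rw [Real.dist_eq, ← tr_sub, ← apply_eval, ← apply_sub]
  refine (abs_tr_apply_le hM hη0.le fun u hu => ?_).trans_lt ?_
  · rw [abs_sub_comm]
    exact (hq u (abs_le.mp hu)).le
  · rw [hη, div_mul_eq_mul_div, div_lt_iff₀ (by positivity)]
    nlinarith

/-- Continuous approximations of the indicator of the negative half line. -/
def negRamp (k : ℕ) (u : ℝ) : ℝ := min 1 (max 0 (-(k * u)))

theorem continuous_negRamp (k : ℕ) : Continuous (negRamp k) := by unfold negRamp; fun_prop

theorem tendsto_negRamp (u : ℝ) : Tendsto (fun k => negRamp k u) atTop (𝓝 (negIndicator u)) := by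
  refine tendsto_const_nhds.congr' ?_
  unfold negRamp negIndicator
  split_ifs with h
  · obtain ⟨n, hn⟩ := exists_nat_ge (-u)⁻¹
    filter_upwards [eventually_ge_atTop n] with k hk
    have h1 : (-u)⁻¹ ≤ k := hn.trans (by exact_mod_cast hk)
    rw [inv_le_iff_one_le_mul₀ (by linarith)] at h1
    rw [max_eq_right (by linarith), min_eq_left (by linarith)]
  · filter_upwards with k
    have : 0 ≤ (k : ℝ) * u := mul_nonneg (by positivity) (not_lt.mp h)
    rw [max_eq_left (by linarith), min_eq_right zero_le_one]

theorem measurable_tr_negIndicator {X : Type*} [TopologicalSpace X] [MeasurableSpace X]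
    [OpensMeasurableSpace X] {x : X → V} (hx : Continuous x) :
    Measurable fun a => tr (apply negIndicator (x a)) := by
  refine measurable_of_tendsto_metrizable (f := fun k a => tr (apply (negRamp k) (x a)))
    (fun k => ((continuous_tr_apply (continuous_negRamp k)).comp hx).measurable) ?_
  refine tendsto_pi_nhds.mpr fun a => ?_
  obtain ⟨n, l, c, hc, h⟩ := exists_csoi (x a)
  simp only [h, hc.tr_apply]
  exact tendsto_finsetSum _ fun i _ => (tendsto_negRamp _).mul_const _

end Measurability

/-! ### The integral formula for the relative entropy. -/

section EntropyFormula

open MeasureTheory Set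

variable {V : Type*} [NonAssocCommRing V] [Module ℝ V] [EuclideanJordanAlgebra V]

/-- The trace of the negative part. -/
def trNeg (x : V) : ℝ := tr (apply (fun u => max (-u) 0) x)

theorem lintegral_tr_negIndicator (x : V) :
    ∫⁻ r in Ioi (0 : ℝ), ENNReal.ofReal (tr (apply negIndicator (x + r • (1 : V)))) =
      ENNReal.ofReal (trNeg x) := by
  obtain ⟨n, l, c, hc, rfl⟩ := exists_csoi x
  have h1 : ∀ r : ℝ, ENNReal.ofReal (tr (apply negIndicator (∑ i, l i • c i + r • (1 : V)))) =
      ∑ i, ENNReal.ofReal (tr (c i)) * ENNReal.ofReal (negIndicator (l i + r)) := fun r => by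
    have : ∑ i, l i • c i + r • (1 : V) = ∑ i, (l i + r) • c i := by
      have := hc.one_add_smul l r 1
      simpa [add_comm] using this
    rw [this, hc.tr_apply, ENNReal.ofReal_sum_of_nonneg]
    · refine Finset.sum_congr rfl fun i _ => ?_
      rw [← ENNReal.ofReal_mul (tr_idempotent_nonneg (hc.idempotent i)), mul_comm]
    · exact fun i _ => mul_nonneg (negIndicator_nonneg _) (tr_idempotent_nonneg (hc.idempotent i))
  have hmeas : ∀ i, Measurable fun r => ENNReal.ofReal (negIndicator (l i + r)) := fun i =>
    (measurable_negIndicator.comp (by fun_prop)).ennreal_ofReal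
  simp_rw [h1]
  rw [lintegral_finsetSum _ fun i _ => (hmeas i).const_mul _, trNeg, hc.tr_apply,
    ENNReal.ofReal_sum_of_nonneg]
  · refine Finset.sum_congr rfl fun i _ => ?_
    rw [lintegral_const_mul _ (hmeas i), lintegral_negIndicator, mul_comm,
      ENNReal.ofReal_mul (le_max_right _ _)]
  · exact fun i _ => mul_nonneg (le_max_right _ _) (tr_idempotent_nonneg (hc.idempotent i))

/-- Frenkel's integral formula for the relative entropy. -/
theorem lintegral_relativeEntropy {ρ σ : V} (hρ : ρ ∈ squareCone V) (hσ : σ ∈ squareCone V)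
    (htr : tr ρ = tr σ) (hsupp : tr (ρ * kernelIdempotent σ) = 0) :
    0 ≤ tr (ρ * log ρ - ρ * log σ) ∧
    ∫⁻ u, ENNReal.ofReal (weight u) * ENNReal.ofReal (trNeg (σ + u • (ρ - σ))) =
      ENNReal.ofReal (tr (ρ * log ρ - ρ * log σ)) := by
  obtain ⟨n, l, c, hc⟩ := exists_isSpectralDecomposition ρ
  obtain ⟨m, μ, d, hd⟩ := exists_isSpectralDecomposition σ
  have hl := hc.nonneg hρ
  have hμ := hd.nonneg hσ
  have hshift : ∀ {n : ℕ} {l : Fin n → ℝ} {c : Fin n → V} {x : V},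
      IsSpectralDecomposition x l c → ∀ r : ℝ, x + r • (1 : V) = ∑ i, (l i + r) • c i := by
    intro n l c x h r
    have := h.csoi.one_add_smul l r 1
    rw [← h.eq_sum] at this
    simpa [add_comm] using this
  set G : ℝ → ℝ := fun r => inner ℝ (ρ - σ) (apply (fun u => u⁻¹) (σ + r • (1 : V))) -
    tr (log (ρ + r • (1 : V))) + tr (log (σ + r • (1 : V))) with hG
  have hpencil : ∀ r > 0, 0 ≤ G r ∧ ∫⁻ u, ENNReal.ofReal (weight u) *
      ENNReal.ofReal (tr (apply negIndicator (σ + u • (ρ - σ) + r • (1 : V)))) =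
      ENNReal.ofReal (G r) := by
    intro r hr
    have hE : σ + r • (1 : V) + (ρ - σ) = ρ + r • (1 : V) := by abel
    have hpos : ∀ i, 0 < l i + r := fun i => add_pos_of_nonneg_of_pos (hl i) hr
    have h := lintegral_pencil hd.csoi (fun j => add_pos_of_nonneg_of_pos (hμ j) hr)
      (hshift hd r) (E := ρ - σ)
      (by rw [hE, hshift hc]; exact quad_injective hc.csoi fun i => (hpos i).ne')
      (by
        rw [hE, hshift hc, hc.csoi.tr_apply]
        exact Finset.sum_eq_zero fun i _ => by
          rw [negIndicator, if_neg (not_lt.mpr (hpos i).le), zero_mul])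
    rw [hE] at h
    simpa only [add_right_comm σ] using h
  have hsc := lintegral_entropy (l := l) (w := fun i => tr (c i)) (μ := μ)
    (v := fun j => tr (d j)) (e := fun j => inner ℝ ρ (d j)) hl hμ
    (by rw [hc.csoi.sum_tr, hd.csoi.sum_tr]) ?_ ?_ ?_ (G := G) ?_ (fun r hr => (hpencil r hr).1)
  · have hD : tr (ρ * log ρ - ρ * log σ) =
        ∑ i, tr (c i) * (l i * Real.log (l i)) - ∑ j, inner ℝ ρ (d j) * Real.log (μ j) := by
      rw [tr_sub, log, log, mul_apply_eq]
      congr 1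
      · conv_lhs => rw [hc.eq_sum, hc.csoi.tr_apply]
        simp only [mul_comm]
      · conv_lhs => rw [tr_mul, hd.eq_sum, hd.csoi.apply_eq, _root_.inner_sum]
        simp only [real_inner_smul_right, mul_comm]
    rw [hD]
    refine ⟨hsc.1, ?_⟩
    -- Tonelli: the r-integral of the u-integrals becomes a u-integral whose inner r-integral is the
    -- trace of the negative part.
    rw [← hsc.2, setLIntegral_congr_fun measurableSet_Ioi fun r hr => ((hpencil r hr).2).symm,
      lintegral_lintegral_swap]
    · refine lintegral_congr fun u => ?_
      rw [lintegral_const_mul, lintegral_tr_negIndicator]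
      exact (measurable_tr_negIndicator (by fun_prop)).ennreal_ofReal
    · refine Measurable.aemeasurable ?_
      refine (measurable_weight.comp measurable_snd).ennreal_ofReal.mul ?_
      exact (measurable_tr_negIndicator
        (x := fun p : ℝ × ℝ => σ + p.2 • (ρ - σ) + p.1 • (1 : V)) (by fun_prop)).ennreal_ofReal
  · rw [← _root_.inner_sum, hd.csoi.complete, ← tr_eq, hc.eq_sum, tr_sum]
    exact Finset.sum_congr rfl fun i _ => by rw [tr_smul, mul_comm]
  · rw [← _root_.inner_sum, hd.csoi.complete, ← tr_eq, htr]
    conv_rhs => rw [hd.eq_sum, tr_sum]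
    exact Finset.sum_congr rfl fun i _ => by rw [tr_smul, mul_comm]
  · intro j hj
    rw [kernelIdempotent, tr_mul, hd.eq_sum, hd.csoi.apply_eq, _root_.inner_sum,
      Finset.sum_eq_zero_iff_of_nonneg] at hsupp
    · have := hsupp j (Finset.mem_univ j)
      simpa [hj] using this
    · intro i _
      have := inner_idempotent_nonneg hρ (hd.csoi.idempotent i)
      split_ifs <;> simp [this]
  · intro r hr
    simp only [hG]
    rw [hshift hc, hshift hd, log, log, hc.csoi.tr_apply, hd.csoi.tr_apply, hd.csoi.apply_eq,
      _root_.inner_sum]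
    congr 1
    · congr 1
      · refine Finset.sum_congr rfl fun j _ => ?_
        rw [real_inner_smul_right, inner_sub_left, mul_comm]
        congr 2
        conv_lhs => rw [hd.eq_sum, hd.csoi.inner_sum]
        rw [mul_comm]
      · simp only [mul_comm]
    · simp only [mul_comm]

end EntropyFormula

/-! ### Monotonicity under positive trace preserving maps. -/

section Positive

variable {V : Type*} [NonAssocCommRing V] [Module ℝ V] [EuclideanJordanAlgebra V]

theorem exists_pos_part (x : V) :
    ∃ p ∈ squareCone V, ∃ q ∈ squareCone V, x = p - q ∧ tr q = trNeg x := by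
  obtain ⟨n, l, c, hc, rfl⟩ := exists_csoi x
  refine ⟨∑ i, max (l i) 0 • c i, hc.sum_mem_squareCone fun i => le_max_right _ _,
    ∑ i, max (-l i) 0 • c i, hc.sum_mem_squareCone fun i => le_max_right _ _, ?_, ?_⟩
  · rw [← Finset.sum_sub_distrib]
    refine Finset.sum_congr rfl fun i _ => ?_
    rw [← sub_smul, max_zero_sub_max_neg_zero_eq_self]
  · rw [trNeg, hc.apply_eq]

/-- For the negative spectral idempotent e of p - q, the left side is ⟨q, e⟩ - ⟨p, e⟩ ≤ ⟨q, e⟩ ≤ tr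
q. With `exists_pos_part` this makes `trNeg` a minimum over decompositions. -/
theorem trNeg_sub_le {p q : V} (hp : p ∈ squareCone V) (hq : q ∈ squareCone V) :
    trNeg (p - q) ≤ tr q := by
  classical
  obtain ⟨n, l, c, hc, hx⟩ := exists_csoi (p - q)
  set s := Finset.univ.filter fun i => l i < 0
  have h1 : trNeg (p - q) = -inner ℝ (p - q) (∑ i ∈ s, c i) := by
    rw [trNeg, hx, hc.tr_apply, inner_sum, ← Finset.sum_neg_distrib, Finset.sum_filter]
    refine Finset.sum_congr rfl fun i _ => ?_
    rw [hc.inner_sum]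
    split_ifs with h
    · rw [max_eq_left (by linarith)]; ring
    · rw [max_eq_right (by linarith), zero_mul]
  have h2 : inner ℝ q (∑ i ∈ s, c i) + inner ℝ q (∑ i ∈ sᶜ, c i) = tr q := by
    rw [← inner_add_right, Finset.sum_add_sum_compl, hc.complete, tr_eq]
  have h3 := inner_idempotent_nonneg hp (hc.sum_finset_idempotent s)
  have h4 := inner_idempotent_nonneg hq (hc.sum_finset_idempotent sᶜ)
  rw [h1, inner_sub_left]
  linarith

theorem trNeg_map_le {κ : V →ₗ[ℝ] V} (hpos : ∀ z ∈ squareCone V, κ z ∈ squareCone V)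
    (htr : IsTracePreserving κ) (x : V) : trNeg (κ x) ≤ trNeg x := by
  obtain ⟨p, hp, q, hq, hx, hq'⟩ := exists_pos_part x
  rw [← hq', ← htr q, hx, map_sub]
  exact trNeg_sub_le (hpos p hp) (hpos q hq)

theorem kernelIdempotent_mul_self (x : V) :
    kernelIdempotent x * kernelIdempotent x = kernelIdempotent x := by
  obtain ⟨n, l, c, hc, rfl⟩ := exists_csoi x
  rw [kernelIdempotent, hc.apply_eq, hc.sum_mul_sum]
  exact Finset.sum_congr rfl fun i _ => by split_ifs <;> simp

theorem tr_mul_kernelIdempotent (x : V) : tr (x * kernelIdempotent x) = 0 := by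
  rw [kernelIdempotent, mul_apply_eq]
  have : (fun u : ℝ => u * if u = 0 then 1 else 0) = fun _ => 0 := by
    ext u; split_ifs with h <;> simp [h]
  rw [this, apply_const, zero_smul, tr_eq, inner_zero_left]

/-- A positive functional vanishing at `σ` vanishes on all elements supported in `σ`. -/
theorem eq_zero_of_support {ρ σ : V} (hρ : ρ ∈ squareCone V) (hσ : σ ∈ squareCone V)
    (hsupp : tr (ρ * kernelIdempotent σ) = 0) (φ : V →ₗ[ℝ] ℝ)
    (hφ : ∀ e : V, e * e = e → 0 ≤ φ e) (h0 : φ σ = 0) : φ ρ = 0 := by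
  classical
  obtain ⟨n, l, c, hc⟩ := exists_isSpectralDecomposition ρ
  obtain ⟨m, μ, d, hd⟩ := exists_isSpectralDecomposition σ
  have hl := hc.nonneg hρ
  have hμ := hd.nonneg hσ
  set k := kernelIdempotent σ with hk
  have hkk : k * k = k := kernelIdempotent_mul_self σ
  have hcompl : φ (1 - k) = 0 := by
    have h1 : φ σ = ∑ j, μ j * φ (d j) := by
      conv_lhs => rw [hd.eq_sum, map_sum]
      simp
    rw [h0, eq_comm, Finset.sum_eq_zero_iff_of_nonneg
      fun j _ => mul_nonneg (hμ j) (hφ _ (hd.csoi.idempotent j))] at h1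
    have h2 : 1 - k = ∑ j, (1 - if μ j = 0 then (1 : ℝ) else 0) • d j := by
      rw [hk, kernelIdempotent]
      conv_lhs => rw [hd.eq_sum, hd.csoi.apply_eq, ← hd.csoi.complete]
      simp only [sub_smul, one_smul, Finset.sum_sub_distrib]
    rw [h2, map_sum]
    refine Finset.sum_eq_zero fun j _ => ?_
    rcases mul_eq_zero.mp (h1 j (Finset.mem_univ j)) with h | h
    · simp [h]
    · simp [h]
  have hck : ∀ i, l i ≠ 0 → φ (c i) = 0 := fun i hi => by
    have hsum : ∑ i, l i * inner ℝ (c i) k = 0 := by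
      rw [tr_mul, hc.eq_sum, sum_inner] at hsupp
      simpa only [real_inner_smul_left] using hsupp
    rw [Finset.sum_eq_zero_iff_of_nonneg fun i _ => mul_nonneg (hl i) (inner_idempotent_nonneg
      (mem_squareCone_of_idempotent (hc.csoi.idempotent i)) hkk)] at hsum
    have h1 := (mul_eq_zero.mp (hsum i (Finset.mem_univ i))).resolve_left hi
    have h2 : k * c i = 0 :=
      mul_eq_zero_of_inner_eq_zero hkk (by rwa [hc.csoi.idempotent i])
    -- As cᵢ is orthogonal to k, this is an idempotent, so 0 ≤ φ(cᵢ) ≤ φ(1 - k) = 0.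
    have h3 : (1 - k - c i) * (1 - k - c i) = 1 - k - c i := by
      simp only [sub_mul, mul_sub, one_mul, mul_one, hkk, hc.csoi.idempotent i, h2,
        mul_comm (c i) k]
      abel
    have h4 := hφ _ h3
    rw [map_sub, hcompl] at h4
    exact le_antisymm (by linarith) (hφ _ (hc.csoi.idempotent i))
  rw [hc.eq_sum, map_sum]
  refine Finset.sum_eq_zero fun i _ => ?_
  by_cases hi : l i = 0
  · simp [hi]
  · simp [hck i hi]

theorem tr_mul_kernelIdempotent_map {κ : V →ₗ[ℝ] V}
    (hpos : ∀ z ∈ squareCone V, κ z ∈ squareCone V) {ρ σ : V} (hρ : ρ ∈ squareCone V)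
    (hσ : σ ∈ squareCone V) (hsupp : tr (ρ * kernelIdempotent σ) = 0) :
    tr (κ ρ * kernelIdempotent (κ σ)) = 0 := by
  rw [tr_mul, real_inner_comm]
  refine eq_zero_of_support hρ hσ hsupp ((innerₗ V (kernelIdempotent (κ σ))).comp κ)
    (fun e he => ?_) ?_
  · rw [LinearMap.comp_apply, innerₗ_apply_apply, real_inner_comm]
    exact inner_idempotent_nonneg (hpos e (mem_squareCone_of_idempotent he))
      (kernelIdempotent_mul_self _)
  · rw [LinearMap.comp_apply, innerₗ_apply_apply, real_inner_comm, ← tr_mul,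
      tr_mul_kernelIdempotent]

/-- Monotonicity of the relative entropy under positive trace preserving maps. -/
theorem relativeEntropy_map_le {κ : V →ₗ[ℝ] V}
    (hpos : ∀ z ∈ squareCone V, κ z ∈ squareCone V) (htr : IsTracePreserving κ) {ρ σ : V}
    (hρ : ρ ∈ squareCone V) (hσ : σ ∈ squareCone V) (h : tr ρ = tr σ) :
    relativeEntropy (κ ρ) (κ σ) ≤ relativeEntropy ρ σ := by
  by_cases hsupp : tr (ρ * kernelIdempotent σ) = 0
  · have hsupp' := tr_mul_kernelIdempotent_map hpos hρ hσ hsupp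
    rw [relativeEntropy, relativeEntropy, if_pos hsupp, if_pos hsupp', EReal.coe_le_coe_iff]
    obtain ⟨h0, h1⟩ := lintegral_relativeEntropy hρ hσ h hsupp
    obtain ⟨-, h2⟩ := lintegral_relativeEntropy (hpos ρ hρ) (hpos σ hσ)
      (by rw [htr, htr, h]) hsupp'
    rw [← ENNReal.ofReal_le_ofReal_iff h0, ← h1, ← h2]
    refine MeasureTheory.lintegral_mono fun u => ?_
    rw [← map_sub, ← map_smul, ← map_add]
    exact mul_le_mul_right (ENNReal.ofReal_le_ofReal (trNeg_map_le hpos htr _)) _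
  · rw [relativeEntropy, relativeEntropy, if_neg hsupp]
    exact le_top

end Positive

/-! ### Complete positivity implies positivity, by taking W = ℝ. -/

section CompletelyPositive

/-- The real numbers as a Euclidean Jordan algebra. -/
abbrev realEuclideanJordanAlgebra : EuclideanJordanAlgebra ℝ where
  inner x y := x * y
  conj_inner_symm x y := by simp [mul_comm]
  re_inner_nonneg x := by simpa using mul_self_nonneg x
  add_left x y z := add_mul x y z
  smul_left x y r := by simp [mul_assoc]
  definite x hx := mul_self_eq_zero.mp hx
  inner_mul_assoc x y z := mul_assoc x y z

variable {V : Type*} [NonAssocCommRing V] [Module ℝ V] [EuclideanJordanAlgebra V]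

omit [EuclideanJordanAlgebra V] in
theorem tmul_one_surjective (z : V ⊗[ℝ] ℝ) : ∃ v : V, z = v ⊗ₜ[ℝ] (1 : ℝ) := by
  refine ⟨TensorProduct.rid ℝ V z, ?_⟩
  rw [← TensorProduct.rid_symm_apply, LinearEquiv.symm_apply_apply]

/-- A completely positive map is positive. -/
theorem IsCompletelyPositive.map_mem_squareCone {κ : V →ₗ[ℝ] V} (hκ : IsCompletelyPositive κ) :
    ∀ z ∈ squareCone V, κ z ∈ squareCone V := by
  rintro _ ⟨x, rfl⟩
  have hJ : @CompositeIsJordan V ℝ _ _ _ _ _ realEuclideanJordanAlgebra := by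
    intro a b
    obtain ⟨a, rfl⟩ := tmul_one_surjective a
    obtain ⟨b, rfl⟩ := tmul_one_surjective b
    simp only [Algebra.TensorProduct.tmul_mul_tmul, mul_one, IsCommJordan.lmul_comm_rmul_rmul]
  obtain ⟨w, hw⟩ := @hκ ℝ _ _ realEuclideanJordanAlgebra hJ hJ ((x * x) ⊗ₜ[ℝ] (1 : ℝ))
    ⟨x ⊗ₜ[ℝ] (1 : ℝ), by rw [Algebra.TensorProduct.tmul_mul_tmul, mul_one]⟩
  obtain ⟨v, rfl⟩ := tmul_one_surjective w
  rw [Algebra.TensorProduct.tmul_mul_tmul, mul_one, TensorProduct.map_tmul,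
    LinearMap.id_apply] at hw
  have := congrArg (TensorProduct.rid ℝ V) hw
  simp only [TensorProduct.rid_tmul, one_smul] at this
  exact ⟨v, this⟩

end CompletelyPositive

end EuclideanJordanAlgebra

end

theorem theorem4p3 {V : Type*} [NonAssocCommRing V] [Module ℝ V] [EuclideanJordanAlgebra V]
    (ρ σ : V) (hρ : EuclideanJordanAlgebra.IsState ρ) (hσ : EuclideanJordanAlgebra.IsState σ)
    (κ : V →ₗ[ℝ] V) (hκ : EuclideanJordanAlgebra.IsTPCP κ) :
    EuclideanJordanAlgebra.relativeEntropy (κ ρ) (κ σ) ≤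
      EuclideanJordanAlgebra.relativeEntropy ρ σ :=
  EuclideanJordanAlgebra.relativeEntropy_map_le hκ.completelyPositive.map_mem_squareCone
    hκ.tracePreserving hρ.mem_cone hσ.mem_cone (hρ.inner_one.trans hσ.inner_one.symm)
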